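/- Let $H^U$ be the Hilbert space of absolutely continuous $h:\mathbb R\to\mathbb R$ with $\|h\|_{H^U}^2=\int_{\mathbb R}\bigl(\tfrac14h(t)^2+\dot h(t)^2\bigr)\,dt<\infty$, and let $\mathcal U$ be the Banach space of continuous $\omega:\mathbb R\to\mathbb R$ with $\lim_{|t|\to\infty}|\omega(t)|/\log|t|=0$ and norm $\|\omega\|_{\mathcal U}=\sup_t|\omega(t)|/\log(e+|t|)$. Let $\mathcal W$ be the Borel probability measure on $\mathcal U$ for which $(H^U,\mathcal U,\mathcal W)$ is an abstract Wiener space, i.e. every $x^*\in\mathcal U^*$ is, under $\mathcal W$, a centered Gaussian variable with variance $\|h_{x^*}\|_{H^U}^2$, where $(h,h_{x^*})_{H^U}=\langle h,x^*\rangle$ for all $h\in H^U$. Let $\mathcal I:H^U\to L^2(\mathcal W)$ be the isometry with $\mathcal I(h_{x^*})=\langle\cdot,x^*\rangle$. For $u\in\mathbb R$ let $\mathcal S^u$ be the orthogonal transformation of $H^U$ given by $\widehat{\mathcal S^uh}(\lambda)=e^{-2iu\operatorname{Arctg}(2\lambda)}\,\widehat h(\lambda)$, where $\widehat h(\lambda)=\int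 e^{-i\lambda t}h(t)\,dt$ (in the $L^2$ sense), and let $S^u:\mathcal U\to\mathcal U$ be the associated transformation, i.e. the ($\mathcal W$-almost surely unique, $\mathcal W$-measurable) map such that $\mathcal I(h)\circ S^u=\mathcal I((\mathcal S^u)^{\top}h)$ $\mathcal W$-almost surely for every $h\in H^U$. Then such maps $S^u$ exist, and for every choice of them, writing $S^u\omega(t)=(S^u(\omega))(t)$ and $\mathbb E$ for the expectation under $\mathcal W$: 1. $\{S^u\omega(t):(u,t)\in\mathbb R^2\}$ is a centered Gaussian family in $L^2(\mathcal W)$, and for all $u,v,s,t\in\mathbb R$ $$\mathbb E\bigl[S^u\omega(s)\,S^v\omega(t)\bigr]=\frac2\pi\int_{-\infty}^{\infty}\frac{e^{i[(t-s)\lambda+2(u-v)\operatorname{Arctg}(2\lambda)]}}{1+4\lambda^2}\,d\lambda .$$ 2. The family is stationary: its finite-dimensional distributions are invariant under every translation of the index set $\mathbb R^2$. 3. There is a constant $C<\infty$ such that for all $u,v,s,t\in\mathbb R$ $$\bigl|1-\mathbb E[S^u\omega(s)S^v\omega(t)]\bigr|\le C\Bigl[|u-v|+|t-s|\Bigl(1+\log\Bigl(1+\frac1{(t-s)^2}\Bigr)\Bigr)\Bigr],$$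 where the second term in the bracket is read as $0$ if $t=s$. 4. For each fixed $u$, the process $(S^u\omega(t))_{t\in\mathbb R}$ is a standard stationary Ornstein–Uhlenbeck process, i.e. a centered Gaussian process with continuous paths and covariance $e^{-|t-s|/2}$. 5. There is a modification $Y$ of the family, i.e. measurable $Y(u,t):\mathcal U\to\mathbb R$ with $Y(u,t)(\omega)=S^u\omega(t)$ for $\mathcal W$-almost every $\omega$, for each $(u,t)\in\mathbb R^2$, such that $(u,t)\mapsto Y(u,t)(\omega)$ is continuous on $\mathbb R^2$ for every $\omega$; for each fixed $u$, $(Y(u,t))_{t\in\mathbb R}$ is again a standard stationary Ornstein–Uhlenbeck process. -/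

import Mathlib

open MeasureTheory ProbabilityTheory Filter Topology
open scoped ZeroAtInfty FourierTransform InnerProductSpace SchwartzMap LineDeriv

namespace WienerFlow

noncomputable section

/-! ### The Banach space `𝒰` of paths -/

/-- Continuous `ω : ℝ → ℝ` with `|ω t| / log |t| → 0` as `|t| → ∞`. -/
def pathSubmodule : Submodule ℝ (ℝ → ℝ) where
  carrier := {ω | Continuous ω ∧
    Tendsto (fun t : ℝ => |ω t| / Real.log |t|) (cocompact ℝ) (𝓝 0)}
  zero_mem' := ⟨continuous_const, by simp⟩
  add_mem' := by
    rintro f g ⟨hf, hf0⟩ ⟨hg, hg0⟩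
    refine ⟨hf.add hg, ?_⟩
    have hlog : ∀ᶠ t : ℝ in cocompact ℝ, 0 ≤ Real.log |t| := by
      filter_upwards [tendsto_norm_cocompact_atTop.eventually (eventually_ge_atTop (1 : ℝ))] with t ht
      exact Real.log_nonneg ht
    have h := hf0.add hg0
    rw [add_zero] at h
    refine tendsto_of_tendsto_of_tendsto_of_le_of_le' tendsto_const_nhds h ?_ ?_
    · filter_upwards [hlog] with t ht
      positivity
    · filter_upwards [hlog] with t ht
      rw [← add_div]
      exact div_le_div_of_nonneg_right (abs_add_le _ _) ht
  smul_mem' := by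
    rintro c f ⟨hf, hf0⟩
    refine ⟨hf.const_smul c, ?_⟩
    have h := hf0.const_mul |c|
    rw [mul_zero] at h
    refine h.congr fun t => ?_
    simp [abs_mul, mul_div_assoc]

/-- The path space `𝒰`. It is a type of its own, so that it carries the norm below and not the
topology of pointwise convergence. -/
def PathSpace : Type := pathSubmodule

instance : AddCommGroup PathSpace := inferInstanceAs (AddCommGroup pathSubmodule)
instance : Module ℝ PathSpace := inferInstanceAs (Module ℝ pathSubmodule)
instance : FunLike PathSpace ℝ ℝ := ⟨fun ω => ω.1, Subtype.val_injective⟩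

theorem PathSpace.continuous (ω : PathSpace) : Continuous ω := ω.2.1

theorem PathSpace.ext {ω η : PathSpace} (h : ∀ t, ω t = η t) : ω = η := DFunLike.ext _ _ h

/-- The weight `log (e + |t|)`. -/
def logWeight (t : ℝ) : ℝ := Real.log (Real.exp 1 + |t|)

theorem one_le_logWeight (t : ℝ) : 1 ≤ logWeight t := by
  have : Real.log (Real.exp 1) ≤ logWeight t :=
    Real.log_le_log (Real.exp_pos 1) (by linarith [abs_nonneg t])
  simpa using this

theorem logWeight_pos (t : ℝ) : 0 < logWeight t := lt_of_lt_of_le one_pos (one_le_logWeight t)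

theorem continuous_logWeight : Continuous logWeight :=
  Continuous.log (by fun_prop) fun t => (by positivity : Real.exp 1 + |t| ≠ 0)

/-- `ω ↦ ω / log (e + |·|)`, with values in the Banach space `C₀(ℝ, ℝ)`. -/
def PathSpace.toC0 : PathSpace →ₗ[ℝ] C₀(ℝ, ℝ) where
  toFun ω :=
    { toFun := fun t => ω t / logWeight t
      continuous_toFun := ω.continuous.div continuous_logWeight fun t => (logWeight_pos t).ne'
      zero_at_infty' := by
        refine squeeze_zero_norm' ?_ ω.2.2
        filter_upwards [tendsto_norm_cocompact_atTop.eventually (eventually_gt_atTop (1 : ℝ))]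
          with t ht
        rw [Real.norm_eq_abs] at ht
        rw [norm_div, Real.norm_eq_abs, Real.norm_eq_abs, abs_of_pos (logWeight_pos t)]
        exact div_le_div_of_nonneg_left (abs_nonneg _) (Real.log_pos ht)
          (Real.log_le_log (by linarith) (by linarith [Real.exp_pos 1])) }
  map_add' ω η := by ext t; exact add_div (ω t) (η t) (logWeight t)
  map_smul' c ω := by ext t; exact mul_div_assoc c (ω t) (logWeight t)

theorem PathSpace.toC0_injective : Function.Injective PathSpace.toC0 := by
  intro ω η h
  refine PathSpace.ext fun t => ?_
  have : ω t / logWeight t = η t / logWeight t := DFunLike.congr_fun h t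
  exact (div_left_inj' (logWeight_pos t).ne').1 this

theorem PathSpace.toC0_surjective : Function.Surjective PathSpace.toC0 := by
  intro g
  refine ⟨⟨fun t => g t * logWeight t, g.continuous.mul continuous_logWeight, ?_⟩, ?_⟩
  · have h := (g.zero_at_infty'.abs).const_mul 2
    rw [abs_zero, mul_zero] at h
    refine squeeze_zero_norm' ?_ h
    filter_upwards [tendsto_norm_cocompact_atTop.eventually (eventually_ge_atTop (Real.exp 1))]
      with t ht
    rw [Real.norm_eq_abs] at ht
    have he : 2 ≤ Real.exp 1 := by linarith [Real.add_one_le_exp 1]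
    have hlog : 1 ≤ Real.log |t| := by
      have := Real.log_le_log (Real.exp_pos 1) ht
      simpa using this
    have hw : logWeight t ≤ 2 * Real.log |t| := by
      have h1 : logWeight t ≤ Real.log (|t| ^ 2) :=
        Real.log_le_log (by positivity) (by nlinarith)
      simpa [Real.log_pow] using h1
    have hw0 := logWeight_pos t
    change ‖|g t * logWeight t| / Real.log |t|‖ ≤ 2 * |g t|
    rw [Real.norm_eq_abs, abs_of_nonneg (by positivity), abs_mul, abs_of_pos hw0,
      div_le_iff₀ (by linarith)]
    nlinarith [abs_nonneg (g t)]
  · ext t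
    exact mul_div_cancel_right₀ _ (logWeight_pos t).ne'

/-- The norm `‖ω‖ = sup_t |ω t| / log (e + |t|)`. -/
instance : NormedAddCommGroup PathSpace :=
  NormedAddCommGroup.induced PathSpace C₀(ℝ, ℝ) PathSpace.toC0 PathSpace.toC0_injective

instance : NormedSpace ℝ PathSpace := NormedSpace.induced ℝ PathSpace C₀(ℝ, ℝ) PathSpace.toC0

theorem PathSpace.norm_toC0 (ω : PathSpace) : ‖PathSpace.toC0 ω‖ = ‖ω‖ := rfl

theorem PathSpace.norm_eq (ω : PathSpace) : ‖ω‖ = ⨆ t : ℝ, |ω t| / logWeight t := by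
  rw [← PathSpace.norm_toC0, ← ZeroAtInftyContinuousMap.norm_toBCF_eq_norm,
    BoundedContinuousFunction.norm_eq_iSup_norm]
  refine iSup_congr fun t => ?_
  change ‖ω t / logWeight t‖ = _
  rw [norm_div, Real.norm_eq_abs, Real.norm_eq_abs, abs_of_pos (logWeight_pos t)]

instance : CompleteSpace PathSpace :=
  let e : PathSpace ≃ₗᵢ[ℝ] C₀(ℝ, ℝ) :=
    { LinearEquiv.ofBijective PathSpace.toC0
        ⟨PathSpace.toC0_injective, PathSpace.toC0_surjective⟩ with
      norm_map' := fun _ => rfl }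
  e.toIsometryEquiv.completeSpace_iff.2 inferInstance

instance : MeasurableSpace PathSpace := borel PathSpace
instance : BorelSpace PathSpace := ⟨rfl⟩

/-! ### The Hilbert space `H^U` -/

theorem ae_differentiableAt_of_ac {h : ℝ → ℝ} (hh : ∀ a b, AbsolutelyContinuousOnInterval h a b) :
    ∀ᵐ x, DifferentiableAt ℝ h x := by
  have : ∀ᵐ x : ℝ, ∀ n : ℕ, x ∈ Set.uIcc (-(n : ℝ)) n → DifferentiableAt ℝ h x :=
    ae_all_iff.2 fun n => (hh _ _).ae_differentiableAt
  filter_upwards [this] with x hx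
  obtain ⟨n, hn⟩ := exists_nat_ge |x|
  refine hx n ?_
  rw [Set.uIcc_of_le (by linarith [abs_nonneg x])]
  exact abs_le.1 hn

theorem deriv_add_ae {f g : ℝ → ℝ} (hf : ∀ a b, AbsolutelyContinuousOnInterval f a b)
    (hg : ∀ a b, AbsolutelyContinuousOnInterval g a b) :
    deriv (f + g) =ᵐ[volume] deriv f + deriv g := by
  filter_upwards [ae_differentiableAt_of_ac hf, ae_differentiableAt_of_ac hg] with x h1 h2
  exact deriv_add h1 h2

theorem deriv_smul_eq (c : ℝ) (f : ℝ → ℝ) : deriv (c • f) = c • deriv f := by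
  ext x
  exact deriv_const_smul_field c f

/-- Locally absolutely continuous `h : ℝ → ℝ` with `∫ (h ^ 2 / 4 + h' ^ 2) < ∞`. -/
def energySubmodule : Submodule ℝ (ℝ → ℝ) where
  carrier := {h | (∀ a b, AbsolutelyContinuousOnInterval h a b) ∧
    MemLp h 2 volume ∧ MemLp (deriv h) 2 volume}
  zero_mem' := by
    refine ⟨fun a b => ?_, MemLp.zero, ?_⟩
    · exact ContDiffOn.absolutelyContinuousOnInterval contDiffOn_const
    · have : deriv (0 : ℝ → ℝ) = 0 := by ext x; exact deriv_const x 0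
      rw [this]; exact MemLp.zero
  add_mem' := by
    rintro f g ⟨hf, hf2, hf3⟩ ⟨hg, hg2, hg3⟩
    exact ⟨fun a b => (hf a b).add (hg a b), hf2.add hg2,
      (hf3.add hg3).ae_eq (deriv_add_ae hf hg).symm⟩
  smul_mem' := by
    rintro c f ⟨hf, hf2, hf3⟩
    refine ⟨fun a b => (hf a b).const_smul c, hf2.const_smul c, ?_⟩
    rw [deriv_smul_eq]
    exact hf3.const_smul c

/-- The Hilbert space `H^U`. It is a type of its own, so that it carries the norm below and not the
topology of pointwise convergence. -/
def EnergySpace : Type := energySubmodule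

namespace EnergySpace

instance : AddCommGroup EnergySpace := inferInstanceAs (AddCommGroup energySubmodule)
instance : Module ℝ EnergySpace := inferInstanceAs (Module ℝ energySubmodule)
instance : FunLike EnergySpace ℝ ℝ := ⟨fun h => h.1, Subtype.val_injective⟩

theorem ext {g h : EnergySpace} (H : ∀ t, g t = h t) : g = h := DFunLike.ext _ _ H

theorem ac (h : EnergySpace) (a b : ℝ) : AbsolutelyContinuousOnInterval h a b := h.2.1 a b
theorem memLp (h : EnergySpace) : MemLp h 2 volume := h.2.2.1
theorem memLp_deriv (h : EnergySpace) : MemLp (deriv h) 2 volume := h.2.2.2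

theorem continuous (h : EnergySpace) : Continuous h := by
  rw [continuous_iff_continuousAt]
  intro x
  have := (h.ac (x - 1) (x + 1)).continuousOn
  rw [Set.uIcc_of_le (by linarith)] at this
  exact this.continuousAt (Icc_mem_nhds (by linarith) (by linarith))

theorem deriv_add_ae (g h : EnergySpace) : deriv (g + h : EnergySpace) =ᵐ[volume] deriv g + deriv h :=
  WienerFlow.deriv_add_ae g.ac h.ac

theorem deriv_smul (c : ℝ) (h : EnergySpace) : deriv (c • h : EnergySpace) = c • deriv h :=
  deriv_smul_eq c h

theorem integrable_mul {f g : ℝ → ℝ} (hf : MemLp f 2 volume) (hg : MemLp g 2 volume) :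
    Integrable (fun t => f t * g t) volume := hf.integrable_mul hg

theorem integrable_energy (g h : EnergySpace) :
    Integrable (fun t => 1 / 4 * (g t * h t) + deriv g t * deriv h t) volume :=
  ((integrable_mul g.memLp h.memLp).const_mul _).add (integrable_mul g.memLp_deriv h.memLp_deriv)

/-- The inner product `(g, h) = ∫ (g h / 4 + g' h')`. -/
abbrev core : InnerProductSpace.Core ℝ EnergySpace where
  inner g h := ∫ t, (1 / 4 * (g t * h t) + deriv g t * deriv h t)
  conj_inner_symm g h := by
    simp only [conj_trivial]
    exact integral_congr_ae (.of_forall fun t => by ring)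
  re_inner_nonneg h := by
    refine integral_nonneg fun t => ?_
    have h1 := mul_self_nonneg (h t)
    have h2 := mul_self_nonneg (deriv h t)
    change 0 ≤ 1 / 4 * (h t * h t) + deriv h t * deriv h t
    linarith
  add_left f g h := by
    rw [← integral_add (integrable_energy f h) (integrable_energy g h)]
    refine integral_congr_ae ?_
    filter_upwards [deriv_add_ae f g] with t ht
    rw [ht]
    change 1 / 4 * ((f t + g t) * h t) + (deriv f t + deriv g t) * deriv h t = _
    ring
  smul_left g h c := by
    rw [conj_trivial, ← integral_const_mul]
    refine integral_congr_ae (.of_forall fun t => ?_)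
    beta_reduce
    rw [deriv_smul]
    change 1 / 4 * ((c * g t) * h t) + (c * deriv g t) * deriv h t = _
    ring
  definite h h0 := by
    have hnn : 0 ≤ fun t => 1 / 4 * (h t * h t) + deriv h t * deriv h t := fun t => by
      have h1 := mul_self_nonneg (h t)
      have h2 := mul_self_nonneg (deriv h t)
      change 0 ≤ 1 / 4 * (h t * h t) + deriv h t * deriv h t
      linarith
    have h1 := (integral_eq_zero_iff_of_nonneg hnn (integrable_energy h h)).1 h0
    have h2 : (h : ℝ → ℝ) =ᵐ[volume] fun _ => 0 := by
      filter_upwards [h1] with t ht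
      have h1 := mul_self_nonneg (h t)
      have h2 := mul_self_nonneg (deriv h t)
      have h3 : 1 / 4 * (h t * h t) + deriv h t * deriv h t = 0 := ht
      exact mul_self_eq_zero.1 (by linarith)
    have h3 := Measure.eq_of_ae_eq h2 h.continuous continuous_const
    exact ext fun t => congrFun h3 t

instance : NormedAddCommGroup EnergySpace := core.toNormedAddCommGroup
instance : InnerProductSpace ℝ EnergySpace := .ofCore core.toCore

theorem inner_eq (g h : EnergySpace) :
    ⟪g, h⟫_ℝ = ∫ t, (1 / 4 * (g t * h t) + deriv g t * deriv h t) := rfl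

theorem norm_sq_eq (h : EnergySpace) :
    ‖h‖ ^ 2 = ∫ t, (1 / 4 * h t ^ 2 + deriv h t ^ 2) := by
  rw [← real_inner_self_eq_norm_sq, inner_eq]
  exact integral_congr_ae (.of_forall fun t => by ring)

theorem integral_deriv (h : EnergySpace) (a b : ℝ) : ∫ t in a..b, deriv h t = h b - h a :=
  (h.ac a b).integral_deriv_eq_sub

theorem integral_mul_deriv_add (g h : EnergySpace) (a b : ℝ) :
    ∫ t in a..b, (deriv g t * h t + g t * deriv h t) = g b * h b - g a * h a :=
  (g.ac a b).integral_deriv_mul_eq_sub (h.ac a b)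

theorem integrable_mul_deriv_add (g h : EnergySpace) :
    Integrable (fun t => deriv g t * h t + g t * deriv h t) :=
  (integrable_mul g.memLp_deriv h.memLp).add (integrable_mul g.memLp h.memLp_deriv)

theorem tendsto_zero_of_sq {l : Filter ℝ} {f : ℝ → ℝ}
    (h : Tendsto (fun t => f t * f t) l (𝓝 0)) : Tendsto f l (𝓝 0) := by
  have h1 := h.sqrt
  simp only [Real.sqrt_mul_self_eq_abs, Real.sqrt_zero] at h1
  exact tendsto_zero_iff_abs_tendsto_zero _ |>.2 h1

theorem tendsto_atTop (h : EnergySpace) : Tendsto h atTop (𝓝 0) := by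
  have h1 := intervalIntegral_tendsto_integral_Ioi 0
    (integrable_mul_deriv_add h h).integrableOn tendsto_id
  simp_rw [id, integral_mul_deriv_add] at h1
  have h2 := h1.add_const (h 0 * h 0)
  simp only [sub_add_cancel] at h2
  have hint : IntegrableAtFilter (fun t => h t * h t) atTop :=
    ⟨Set.univ, univ_mem, (integrable_mul h.memLp h.memLp).integrableOn⟩
  have h0 := hint.eq_zero_of_tendsto (fun s hs => by
    rcases mem_atTop_sets.1 hs with ⟨b, hb⟩
    rw [← top_le_iff, ← Real.volume_Ici (a := b)]
    exact measure_mono hb) h2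
  rw [h0] at h2
  exact tendsto_zero_of_sq h2

theorem tendsto_atBot (h : EnergySpace) : Tendsto h atBot (𝓝 0) := by
  have h1 := intervalIntegral_tendsto_integral_Iic 0
    (integrable_mul_deriv_add h h).integrableOn tendsto_id
  simp_rw [id, integral_mul_deriv_add] at h1
  have h2 := h1.const_sub (h 0 * h 0)
  simp only [sub_sub_cancel] at h2
  have hint : IntegrableAtFilter (fun t => h t * h t) atBot :=
    ⟨Set.univ, univ_mem, (integrable_mul h.memLp h.memLp).integrableOn⟩
  have h0 := hint.eq_zero_of_tendsto (fun s hs => by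
    rcases mem_atBot_sets.1 hs with ⟨b, hb⟩
    rw [← top_le_iff, ← Real.volume_Iic (a := b)]
    exact measure_mono hb) h2
  rw [h0] at h2
  exact tendsto_zero_of_sq h2

theorem integral_Iic_mul_deriv (g h : EnergySpace) (t : ℝ) :
    ∫ s in Set.Iic t, (deriv g s * h s + g s * deriv h s) = g t * h t := by
  have h1 := intervalIntegral_tendsto_integral_Iic t
    (integrable_mul_deriv_add g h).integrableOn tendsto_id
  simp_rw [id, integral_mul_deriv_add] at h1
  have h2 := (g.tendsto_atBot.mul h.tendsto_atBot).const_sub (g t * h t)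
  simpa using tendsto_nhds_unique h1 h2

theorem integral_Ioi_mul_deriv (g h : EnergySpace) (t : ℝ) :
    ∫ s in Set.Ioi t, (deriv g s * h s + g s * deriv h s) = - (g t * h t) := by
  have h1 := intervalIntegral_tendsto_integral_Ioi t
    (integrable_mul_deriv_add g h).integrableOn tendsto_id
  simp_rw [id, integral_mul_deriv_add] at h1
  have h2 := (g.tendsto_atTop.mul h.tendsto_atTop).sub_const (g t * h t)
  simpa using tendsto_nhds_unique h1 h2

theorem integral_mul_deriv (g h : EnergySpace) :
    ∫ s, (deriv g s * h s + g s * deriv h s) = 0 := by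
  rw [← intervalIntegral.integral_Iic_add_Ioi (b := 0)
    (integrable_mul_deriv_add g h).integrableOn (integrable_mul_deriv_add g h).integrableOn,
    integral_Iic_mul_deriv, integral_Ioi_mul_deriv, add_neg_cancel]

theorem abs_apply_le (h : EnergySpace) (t : ℝ) : |h t| ≤ ‖h‖ := by
  refine abs_le_of_sq_le_sq ?_ (norm_nonneg h)
  have hF := integrable_mul_deriv_add h h
  have hE := integrable_energy h h
  rw [← real_inner_self_eq_norm_sq, inner_eq,
    ← intervalIntegral.integral_Iic_add_Ioi (b := t) hE.integrableOn hE.integrableOn]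
  have h1 := integral_mono (μ := volume.restrict (Set.Iic t)) hF.integrableOn
    (hE.integrableOn.const_mul 2) (fun s => by
      change deriv h s * h s + h s * deriv h s ≤ 2 * (1 / 4 * (h s * h s) + deriv h s * deriv h s)
      nlinarith [sq_nonneg (h s - 2 * deriv h s)])
  have h2 := integral_mono (μ := volume.restrict (Set.Ioi t)) hF.neg.integrableOn
    (hE.integrableOn.const_mul 2) (fun s => by
      change -(deriv h s * h s + h s * deriv h s) ≤
        2 * (1 / 4 * (h s * h s) + deriv h s * deriv h s)
      nlinarith [sq_nonneg (h s + 2 * deriv h s)])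
  simp only [Pi.neg_apply] at h2
  rw [integral_const_mul, integral_Iic_mul_deriv] at h1
  rw [integral_const_mul, integral_neg, integral_Ioi_mul_deriv] at h2
  nlinarith

/-- The inclusion of `H^U` in `𝒰`. -/
def toPath : EnergySpace →L[ℝ] PathSpace :=
  LinearMap.mkContinuous
    { toFun := fun h => ⟨h, h.continuous, by
        have h0 : Tendsto (fun t => |h t|) (cocompact ℝ) (𝓝 0) := by
          rw [cocompact_eq_atBot_atTop]
          have := (h.tendsto_atBot.sup h.tendsto_atTop).abs
          rwa [abs_zero] at this
        refine squeeze_zero_norm' ?_ h0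
        filter_upwards [tendsto_norm_cocompact_atTop.eventually (eventually_ge_atTop (Real.exp 1))]
          with t ht
        have hlog : 1 ≤ Real.log |t| := by
          have := Real.log_le_log (Real.exp_pos 1) ht
          simpa using this
        rw [Real.norm_eq_abs, abs_div, abs_abs, abs_of_pos (by linarith : 0 < Real.log |t|)]
        exact div_le_self (abs_nonneg _) hlog⟩
      map_add' := fun _ _ => rfl
      map_smul' := fun _ _ => rfl } 1 (fun h => by
    rw [one_mul, PathSpace.norm_eq]
    refine ciSup_le fun t => ?_
    exact (div_le_self (abs_nonneg _) (one_le_logWeight t)).trans (h.abs_apply_le t))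

@[simp]
theorem toPath_apply (h : EnergySpace) (t : ℝ) : toPath h t = h t := rfl

/-! Completeness: `h ↦ h' + h / 2` is an isometry of `H^U` onto `L²(ℝ)`. -/

theorem norm_sq_eq' (h : EnergySpace) : ‖h‖ ^ 2 = ∫ t, (deriv h t + 1 / 2 * h t) ^ 2 := by
  rw [← real_inner_self_eq_norm_sq, inner_eq]
  have h1 := integral_mul_deriv h h
  have h2 := integral_add (integrable_energy h h) ((integrable_mul_deriv_add h h).const_mul (1 / 2))
  rw [integral_const_mul, h1, mul_zero, add_zero] at h2
  rw [← h2]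
  exact integral_congr_ae (.of_forall fun t => by ring)

theorem memLp_diffOp (h : EnergySpace) : MemLp (fun t => deriv h t + 1 / 2 * h t) 2 volume :=
  h.memLp_deriv.add (h.memLp.const_mul (1 / 2))

/-- `h ↦ h' + h / 2`. -/
def diffOp : EnergySpace →ₗᵢ[ℝ] Lp ℝ 2 (volume : Measure ℝ) where
  toFun h := h.memLp_diffOp.toLp _
  map_add' g h := by
    rw [← MemLp.toLp_add, MemLp.toLp_eq_toLp_iff]
    filter_upwards [deriv_add_ae g h] with t ht
    rw [ht]
    change deriv g t + deriv h t + 1 / 2 * (g t + h t) = 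
      deriv g t + 1 / 2 * g t + (deriv h t + 1 / 2 * h t)
    ring
  map_smul' c h := by
    rw [RingHom.id_apply, ← MemLp.toLp_const_smul, MemLp.toLp_eq_toLp_iff]
    refine .of_forall fun t => ?_
    beta_reduce
    rw [deriv_smul]
    change c * deriv h t + 1 / 2 * (c * h t) = c * (deriv h t + 1 / 2 * h t)
    ring
  norm_map' h := by
    change ‖h.memLp_diffOp.toLp _‖ = ‖h‖
    rw [← sq_eq_sq₀ (norm_nonneg _) (norm_nonneg _), norm_sq_eq', ← real_inner_self_eq_norm_sq,
      L2.inner_def]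
    refine integral_congr_ae ?_
    filter_upwards [h.memLp_diffOp.coeFn_toLp] with t ht
    rw [ht, real_inner_self_eq_norm_sq, Real.norm_eq_abs, sq_abs]

theorem coeFn_diffOp (h : EnergySpace) :
    diffOp h =ᵐ[volume] fun t => deriv h t + 1 / 2 * h t := h.memLp_diffOp.coeFn_toLp


theorem integrable_expKernel :
    Integrable ((Set.Ici (0 : ℝ)).indicator fun s => Real.exp (-(1 / 2) * s)) volume := by
  rw [integrable_indicator_iff measurableSet_Ici, integrableOn_Ici_iff_integrableOn_Ioi]
  exact exp_neg_integrableOn_Ioi (0 : ℝ) (by norm_num)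

theorem exists_diffOp_eq {f : ℝ → ℝ} (hf : MemLp f 2 volume) :
    ∃ h : EnergySpace, (fun t => deriv h t + 1 / 2 * h t) =ᵐ[volume] f := by
  have hexp (t : ℝ) : MemLp (fun s => Real.exp (1 / 2 * s)) 2 (volume.restrict (Set.Iic t)) := by
    rw [memLp_two_iff_integrable_sq (by fun_prop)]
    refine (integrableOn_exp_Iic t).congr (.of_forall fun s => ?_)
    beta_reduce
    rw [← Real.exp_nat_mul]
    congr 1; push_cast; ring
  have hint (t : ℝ) : IntegrableOn (fun s => Real.exp (1 / 2 * s) * f s) (Set.Iic t) :=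
    (hexp t).integrable_mul (hf.restrict _)
  set G : ℝ → ℝ := fun t => ∫ s in Set.Iic t, Real.exp (1 / 2 * s) * f s with hG
  have hii (a b : ℝ) : IntervalIntegrable (fun s => Real.exp (1 / 2 * s) * f s) volume a b :=
    ⟨(hint b).mono_set Set.Ioc_subset_Iic_self, (hint a).mono_set Set.Ioc_subset_Iic_self⟩
  have hGeq (a t : ℝ) : G t = G a + ∫ s in a..t, Real.exp (1 / 2 * s) * f s := by
    rw [← intervalIntegral.integral_Iic_sub_Iic (hint a) (hint t)]
    ring
  have hGac (a b : ℝ) : AbsolutelyContinuousOnInterval G a b := by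
    have h1 : AbsolutelyContinuousOnInterval (fun _ : ℝ => G a) a b :=
      ContDiffOn.absolutelyContinuousOnInterval contDiffOn_const
    have h2 := h1.add ((hii a b).absolutelyContinuousOnInterval_intervalIntegral
      (c := a) Set.left_mem_uIcc)
    convert! h2 using 1
    ext t
    exact hGeq a t
  have hGd : ∀ᵐ t, HasDerivAt G (Real.exp (1 / 2 * t) * f t) t := by
    have hloc : LocallyIntegrable (fun s => Real.exp (1 / 2 * s) * f s) volume := fun x =>
      ⟨Set.Iic (x + 1), Iic_mem_nhds (by linarith), hint _⟩
    filter_upwards [LocallyIntegrable.ae_hasDerivAt_integral hloc] with t ht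
    have h1 := (ht 0).const_add (G 0)
    refine h1.congr_of_eventuallyEq (.of_forall fun s => hGeq 0 s)
  set h : ℝ → ℝ := fun t => Real.exp (-(1 / 2) * t) * G t with hh
  have hac (a b : ℝ) : AbsolutelyContinuousOnInterval h a b :=
    (ContDiffOn.absolutelyContinuousOnInterval
      (f := fun t => Real.exp (-(1 / 2) * t)) (by fun_prop)).fun_mul (hGac a b)
  have hd : ∀ᵐ t, HasDerivAt h (f t - 1 / 2 * h t) t := by
    filter_upwards [hGd] with t ht
    have h1 : HasDerivAt (fun t => Real.exp (-(1 / 2) * t)) (Real.exp (-(1 / 2) * t) * (-(1 / 2)))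
        t := by
      simpa using ((hasDerivAt_id t).const_mul (-(1 / 2) : ℝ)).exp
    refine (h1.mul ht).congr_deriv ?_
    have : Real.exp (-(1 / 2) * t) * Real.exp (1 / 2 * t) = 1 := by
      rw [← Real.exp_add]; simp
    rw [hh]
    linear_combination f t * this
  have hcont : Continuous h := by
    rw [continuous_iff_continuousAt]
    intro x
    have := (hac (x - 1) (x + 1)).continuousOn
    rw [Set.uIcc_of_le (by linarith)] at this
    exact this.continuousAt (Icc_mem_nhds (by linarith) (by linarith))
  have hL2 : MemLp h 2 volume := by
    rw [memLp_two_iff_integrable_sq hcont.aestronglyMeasurable]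
    set k : ℝ → ℝ := (Set.Ici (0 : ℝ)).indicator fun s => Real.exp (-(1 / 2) * s) with hk
    have hsq : Integrable (fun s => f s ^ 2) volume := hf.integrable_sq
    have hae := hsq.ae_convolution_exists (ContinuousLinearMap.mul ℝ ℝ) integrable_expKernel
    have hconv := hsq.integrable_convolution (ContinuousLinearMap.mul ℝ ℝ) integrable_expKernel
    refine (hconv.const_mul 2).mono' (hcont.pow 2).aestronglyMeasurable ?_
    filter_upwards [hae] with t ht
    rw [Real.norm_eq_abs, abs_of_nonneg (sq_nonneg _)]
    have hi2 : Integrable (fun s => f s ^ 2 * k (t - s)) volume := ht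
    have hi0 : Integrable (fun s => k (t - s)) volume := integrable_expKernel.comp_sub_left t
    have hkeq (s : ℝ) : (Set.Iic t).indicator (fun s => Real.exp (1 / 2 * s) * f s) s =
        Real.exp (1 / 2 * t) * (k (t - s) * f s) := by
      by_cases hs : s ≤ t
      · rw [Set.indicator_of_mem (by exact hs), hk, Set.indicator_of_mem (by simpa using hs),
          ← mul_assoc, ← Real.exp_add]
        congr 2; ring
      · rw [Set.indicator_of_notMem (by exact hs), hk, Set.indicator_of_notMem (by simpa using hs)]
        ring
    have hi1 : Integrable (fun s => k (t - s) * f s) volume := by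
      have h1 := (integrable_indicator_iff measurableSet_Iic).2 (hint t)
      have h2 := h1.const_mul (Real.exp (-(1 / 2) * t))
      refine h2.congr (.of_forall fun s => ?_)
      beta_reduce
      rw [hkeq, ← mul_assoc, ← Real.exp_add]
      simp
    have hm : h t = ∫ s, k (t - s) * f s := by
      have h1 : G t = ∫ s, (Set.Iic t).indicator (fun s => Real.exp (1 / 2 * s) * f s) s :=
        (integral_indicator measurableSet_Iic).symm
      simp_rw [hkeq] at h1
      rw [hh]
      beta_reduce
      rw [h1, integral_const_mul, ← mul_assoc, ← Real.exp_add]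
      simp
    have hk2 : ∫ s, k (t - s) = 2 := by
      rw [integral_sub_left_eq_self (fun s => k s) volume t, hk, integral_indicator measurableSet_Ici,
        integral_Ici_eq_integral_Ioi, integral_exp_mul_Ioi (by norm_num)]
      norm_num
    have hnn : 0 ≤ ∫ s, k (t - s) * (f s - h t / 2) ^ 2 := by
      refine integral_nonneg fun s => mul_nonneg ?_ (sq_nonneg _)
      exact Set.indicator_nonneg (fun _ _ => (Real.exp_pos _).le) _
    have hexpand : ∫ s, k (t - s) * (f s - h t / 2) ^ 2 =
        (∫ s, f s ^ 2 * k (t - s)) - h t * (∫ s, k (t - s) * f s)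
          + (h t / 2) ^ 2 * ∫ s, k (t - s) := by
      rw [← integral_const_mul, ← integral_const_mul, ← integral_sub hi2 (hi1.const_mul _),
        ← integral_add (f := fun s => f s ^ 2 * k (t - s) - h t * (k (t - s) * f s))
          (hi2.sub (hi1.const_mul _)) (hi0.const_mul _)]
      refine integral_congr_ae (.of_forall fun s => ?_)
      beta_reduce
      ring
    rw [hexpand, ← hm, hk2] at hnn
    change h t ^ 2 ≤ 2 * ∫ s, f s ^ 2 * k (t - s)
    nlinarith
  have hdae : deriv h =ᵐ[volume] fun t => f t - 1 / 2 * h t := by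
    filter_upwards [hd] with t ht using ht.deriv
  refine ⟨⟨h, hac, hL2, (hf.sub (hL2.const_mul (1 / 2))).ae_eq hdae.symm⟩, ?_⟩
  filter_upwards [hdae] with t ht
  change deriv h t + 1 / 2 * h t = f t
  rw [ht]; ring

theorem diffOp_surjective : Function.Surjective diffOp := by
  intro f
  obtain ⟨h, hh⟩ := exists_diffOp_eq (Lp.memLp f)
  exact ⟨h, Lp.ext ((coeFn_diffOp h).trans hh)⟩

/-- `h ↦ h' + h / 2`, as a unitary map of `H^U` onto `L²(ℝ)`. -/
def diffEquiv : EnergySpace ≃ₗᵢ[ℝ] Lp ℝ 2 (volume : Measure ℝ) :=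
  LinearIsometryEquiv.ofSurjective diffOp diffOp_surjective

instance : CompleteSpace EnergySpace := diffEquiv.toIsometryEquiv.completeSpace_iff.2 inferInstance

end EnergySpace

/-! ### Fourier multipliers -/

/-- The symbol `λ ↦ exp (-2 i u Arctg (2 λ))`. -/
def symbol (u l : ℝ) : ℂ := Complex.exp ((-(2 * u * Real.arctan (2 * l)) : ℝ) * Complex.I)

theorem norm_symbol (u l : ℝ) : ‖symbol u l‖ = 1 := by
  rw [symbol, Complex.norm_exp_ofReal_mul_I]

theorem symbol_add (u v l : ℝ) : symbol (u + v) l = symbol u l * symbol v l := by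
  rw [symbol, symbol, symbol, ← Complex.exp_add]
  congr 1; push_cast; ring

theorem symbol_zero (l : ℝ) : symbol 0 l = 1 := by simp [symbol]

theorem conj_symbol_neg (u l : ℝ) : (starRingEnd ℂ) (symbol u (-l)) = symbol u l := by
  rw [symbol, symbol, ← Complex.exp_conj, map_mul, Complex.conj_ofReal, Complex.conj_I, mul_neg,
    mul_neg, Real.arctan_neg]
  congr 1; push_cast; ring

theorem continuous_symbol (u : ℝ) : Continuous (symbol u) := by
  unfold symbol
  fun_prop

/-- `L²(ℝ; ℂ)`. -/
abbrev L2C : Type := Lp ℂ 2 (volume : Measure ℝ)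
/-- `L²(ℝ; ℝ)`. -/
abbrev L2R : Type := Lp ℝ 2 (volume : Measure ℝ)

/-- `L²(ℝ; ℝ) → L²(ℝ; ℂ)`. -/
def ofRealL : L2R →L[ℝ] L2C := Complex.ofRealCLM.compLpL 2 volume
def reL : L2C →L[ℝ] L2R := Complex.reCLM.compLpL 2 volume
def conjL : L2C →L[ℝ] L2C := (Complex.conjCLE : ℂ →L[ℝ] ℂ).compLpL 2 volume
def reflL : L2C →L[ℝ] L2C :=
  (Lp.compMeasurePreservingₗᵢ ℝ (fun x : ℝ => -x) (Measure.measurePreserving_neg volume)).toContinuousLinearMap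

theorem coeFn_ofRealL (f : L2R) : ofRealL f =ᵐ[volume] fun x => (f x : ℂ) :=
  ContinuousLinearMap.coeFn_compLpL _ _
theorem coeFn_reL (f : L2C) : reL f =ᵐ[volume] fun x => (f x).re :=
  ContinuousLinearMap.coeFn_compLpL _ _
theorem coeFn_conjL (f : L2C) : conjL f =ᵐ[volume] fun x => (starRingEnd ℂ) (f x) :=
  ContinuousLinearMap.coeFn_compLpL _ _
theorem coeFn_reflL (f : L2C) : reflL f =ᵐ[volume] fun x => f (-x) :=
  Lp.coeFn_compMeasurePreserving f (Measure.measurePreserving_neg volume)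

theorem norm_ofRealL (f : L2R) : ‖ofRealL f‖ = ‖f‖ := by
  rw [Lp.norm_def, Lp.norm_def]
  congr 1
  refine eLpNorm_congr_norm_ae ?_
  filter_upwards [coeFn_ofRealL f] with x hx
  rw [hx, Complex.norm_real]

theorem reL_ofRealL (f : L2R) : reL (ofRealL f) = f := by
  refine Lp.ext ?_
  filter_upwards [coeFn_reL (ofRealL f), coeFn_ofRealL f] with x h1 h2
  rw [h1, h2, Complex.ofReal_re]

theorem conjL_ofRealL (f : L2R) : conjL (ofRealL f) = ofRealL f := by
  refine Lp.ext ?_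
  filter_upwards [coeFn_conjL (ofRealL f), coeFn_ofRealL f] with x h1 h2
  rw [h1, h2, Complex.conj_ofReal]

theorem ofRealL_reL {f : L2C} (hf : conjL f = f) : ofRealL (reL f) = f := by
  refine Lp.ext ?_
  have h0 := coeFn_conjL f
  rw [hf] at h0
  filter_upwards [coeFn_ofRealL (reL f), coeFn_reL f, h0] with x h1 h2 h3
  rw [h1, h2]
  exact Complex.conj_eq_iff_re.1 h3.symm

theorem fourier_conjL (f : L2C) : 𝓕 (conjL f) = reflL (conjL (𝓕 f)) := by
  refine DenseRange.induction_on (p := fun f : L2C => 𝓕 (conjL f) = reflL (conjL (𝓕 f)))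
    (SchwartzMap.denseRange_toLpCLM (F := ℂ) (E := ℝ) (p := 2) ENNReal.ofNat_ne_top) f ?_ ?_
  · exact isClosed_eq ((Lp.fourierTransformₗᵢ ℝ ℂ).continuous.comp conjL.continuous)
      (reflL.continuous.comp (conjL.continuous.comp (Lp.fourierTransformₗᵢ ℝ ℂ).continuous))
  · intro φ
    rw [SchwartzMap.toLpCLM_apply]
    have h1 : conjL (φ.toLp 2) =
        (SchwartzMap.postcompCLM (𝕜 := ℝ) (Complex.conjCLE : ℂ →L[ℝ] ℂ) φ).toLp 2 := by
      refine Lp.ext ?_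
      filter_upwards [coeFn_conjL (φ.toLp 2), φ.coeFn_toLp 2 volume,
        (SchwartzMap.postcompCLM (𝕜 := ℝ) (Complex.conjCLE : ℂ →L[ℝ] ℂ) φ).coeFn_toLp 2 volume]
        with x h1 h2 h3
      rw [h1, h2, h3, SchwartzMap.postcompCLM_apply]
      rfl
    rw [h1, SchwartzMap.toLp_fourier_eq, SchwartzMap.toLp_fourier_eq]
    refine Lp.ext ?_
    have h5 : ∀ᵐ x : ℝ, conjL ((𝓕 φ).toLp 2) (-x) = (starRingEnd ℂ) ((𝓕 φ).toLp 2 volume (-x)) :=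
      (Measure.measurePreserving_neg volume).quasiMeasurePreserving.ae (coeFn_conjL _)
    have h6 : ∀ᵐ x : ℝ, (𝓕 φ).toLp 2 volume (-x) = 𝓕 φ (-x) :=
      (Measure.measurePreserving_neg volume).quasiMeasurePreserving.ae ((𝓕 φ).coeFn_toLp 2 volume)
    filter_upwards [coeFn_reflL (conjL ((𝓕 φ).toLp 2)), h5, h6,
      (𝓕 (SchwartzMap.postcompCLM (𝕜 := ℝ) (Complex.conjCLE : ℂ →L[ℝ] ℂ) φ)).coeFn_toLp 2 volume]
      with x h1 h2 h3 h4
    rw [h4, h1, h2, h3, SchwartzMap.fourier_coe, SchwartzMap.fourier_coe, Real.fourier_eq,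
      Real.fourier_eq, ← integral_conj]
    refine integral_congr_ae (.of_forall fun y => ?_)
    beta_reduce
    rw [SchwartzMap.postcompCLM_apply, Circle.smul_def, Circle.smul_def, smul_eq_mul, smul_eq_mul,
      map_mul, ← Circle.coe_inv_eq_conj, ← AddChar.map_neg_eq_inv]
    simp

theorem memLp_symbol_mul (u : ℝ) (f : L2C) :
    MemLp (fun ξ => symbol u (2 * Real.pi * ξ) * f ξ) 2 volume :=
  (Lp.memLp f).of_le (((continuous_symbol u).comp (by fun_prop)).aestronglyMeasurable.mul
    (Lp.aestronglyMeasurable f)) (.of_forall fun ξ => by rw [norm_mul, norm_symbol, one_mul])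

/-- Multiplication by the symbol (in the variable `ξ = λ / 2π`). -/
def mulSymbol (u : ℝ) : L2C →ₗᵢ[ℂ] L2C where
  toFun f := (memLp_symbol_mul u f).toLp _
  map_add' f g := by
    rw [← MemLp.toLp_add, MemLp.toLp_eq_toLp_iff]
    filter_upwards [Lp.coeFn_add f g] with x hx
    rw [hx, Pi.add_apply, Pi.add_apply, mul_add]
  map_smul' c f := by
    rw [RingHom.id_apply, ← MemLp.toLp_const_smul, MemLp.toLp_eq_toLp_iff]
    filter_upwards [Lp.coeFn_smul c f] with x hx
    rw [hx, Pi.smul_apply, Pi.smul_apply, smul_eq_mul, smul_eq_mul, mul_left_comm]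
  norm_map' f := by
    change ‖(memLp_symbol_mul u f).toLp _‖ = ‖f‖
    rw [Lp.norm_toLp, Lp.norm_def]
    congr 1
    refine eLpNorm_congr_norm_ae (.of_forall fun ξ => ?_)
    rw [norm_mul, norm_symbol, one_mul]

theorem coeFn_mulSymbol (u : ℝ) (f : L2C) :
    mulSymbol u f =ᵐ[volume] fun ξ => symbol u (2 * Real.pi * ξ) * f ξ :=
  (memLp_symbol_mul u f).coeFn_toLp

theorem mulSymbol_mulSymbol (u v : ℝ) (f : L2C) :
    mulSymbol u (mulSymbol v f) = mulSymbol (u + v) f := by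
  refine Lp.ext ?_
  filter_upwards [coeFn_mulSymbol u (mulSymbol v f), coeFn_mulSymbol v f,
    coeFn_mulSymbol (u + v) f] with x h1 h2 h3
  rw [h1, h2, h3, symbol_add]; ring

theorem mulSymbol_zero (f : L2C) : mulSymbol 0 f = f := by
  refine Lp.ext ?_
  filter_upwards [coeFn_mulSymbol 0 f] with x h1
  rw [h1, symbol_zero, one_mul]

theorem reflL_conjL_mulSymbol (u : ℝ) (f : L2C) :
    reflL (conjL (mulSymbol u f)) = mulSymbol u (reflL (conjL f)) := by
  refine Lp.ext ?_
  have hq := (Measure.measurePreserving_neg (volume : Measure ℝ)).quasiMeasurePreserving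
  filter_upwards [coeFn_reflL (conjL (mulSymbol u f)), hq.ae (coeFn_conjL (mulSymbol u f)),
    hq.ae (coeFn_mulSymbol u f), coeFn_mulSymbol u (reflL (conjL f)), coeFn_reflL (conjL f),
    hq.ae (coeFn_conjL f)] with x h1 h2 h3 h4 h5 h6
  rw [h1, h2, h3, h4, h5, h6, map_mul, mul_neg, conj_symbol_neg]

/-- The Fourier multiplier on `L²(ℝ; ℂ)`. -/
def multC (u : ℝ) (f : L2C) : L2C := 𝓕⁻ (mulSymbol u (𝓕 f))

theorem fourier_multC (u : ℝ) (f : L2C) : 𝓕 (multC u f) = mulSymbol u (𝓕 f) :=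
  FourierTransform.fourier_fourierInv_eq _

theorem conjL_multC (u : ℝ) {f : L2C} (hf : conjL f = f) : conjL (multC u f) = multC u f := by
  apply (Lp.fourierTransformₗᵢ ℝ ℂ).injective
  change 𝓕 (conjL (multC u f)) = 𝓕 (multC u f)
  rw [fourier_conjL, fourier_multC, reflL_conjL_mulSymbol, ← fourier_conjL, hf]

theorem ofRealL_injective : Function.Injective ofRealL :=
  Function.LeftInverse.injective reL_ofRealL

/-- The Fourier multiplier on `L²(ℝ; ℝ)`. -/
def multR (u : ℝ) (f : L2R) : L2R := reL (multC u (ofRealL f))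

theorem ofRealL_multR (u : ℝ) (f : L2R) : ofRealL (multR u f) = multC u (ofRealL f) :=
  ofRealL_reL (conjL_multC u (conjL_ofRealL f))

theorem fourier_multR (u : ℝ) (f : L2R) :
    𝓕 (ofRealL (multR u f)) = mulSymbol u (𝓕 (ofRealL f)) := by
  rw [ofRealL_multR, fourier_multC]

theorem fourier_ofRealL_injective : Function.Injective fun f : L2R => 𝓕 (ofRealL f) :=
  (Lp.fourierTransformₗᵢ ℝ ℂ).injective.comp ofRealL_injective

theorem multR_multR (u v : ℝ) (f : L2R) : multR u (multR v f) = multR (u + v) f := by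
  apply fourier_ofRealL_injective
  beta_reduce
  rw [fourier_multR, fourier_multR, fourier_multR, mulSymbol_mulSymbol]

theorem multR_zero (f : L2R) : multR 0 f = f := by
  apply fourier_ofRealL_injective
  beta_reduce
  rw [fourier_multR, mulSymbol_zero]

/-- The Fourier multiplier with symbol `symbol u`, as an orthogonal transformation. -/
def multEquiv (u : ℝ) : L2R ≃ₗᵢ[ℝ] L2R where
  toFun := multR u
  invFun := multR (-u)
  left_inv f := by rw [multR_multR, neg_add_cancel, multR_zero]
  right_inv f := by rw [multR_multR, add_neg_cancel, multR_zero]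
  map_add' f g := by
    apply fourier_ofRealL_injective
    beta_reduce
    rw [fourier_multR, map_add, map_add, FourierTransform.fourier_add, FourierTransform.fourier_add,
      map_add, fourier_multR, fourier_multR]
  map_smul' c f := by
    apply fourier_ofRealL_injective
    beta_reduce
    rw [RingHom.id_apply, fourier_multR, map_smul, map_smul,
      RCLike.real_smul_eq_coe_smul (K := ℂ), RCLike.real_smul_eq_coe_smul (K := ℂ),
      FourierTransform.fourier_smul, FourierTransform.fourier_smul, map_smul, fourier_multR]
  norm_map' f := by
    change ‖multR u f‖ = ‖f‖
    rw [← norm_ofRealL, ← Lp.norm_fourier_eq, fourier_multR, LinearIsometry.norm_map,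
      Lp.norm_fourier_eq, norm_ofRealL]

namespace EnergySpace

/-- Schwartz functions belong to `H^U`. -/
def ofSchwartz (φ : 𝓢(ℝ, ℝ)) : EnergySpace :=
  ⟨φ, fun _ _ => (φ.smooth 1).contDiffOn.absolutelyContinuousOnInterval, φ.memLp 2 volume,
    (SchwartzMap.derivCLM ℝ ℝ φ).memLp 2 volume⟩

/-- `h ∈ H^U` as an element of `L²(ℝ; ℂ)`. -/
def toL2C (h : EnergySpace) : L2C := ofRealL (h.memLp.toLp _)

/-- The weak derivative of `h ∈ H^U` as an element of `L²(ℝ; ℂ)`. -/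
def derivL2C (h : EnergySpace) : L2C := ofRealL (h.memLp_deriv.toLp _)

theorem coeFn_toL2C (h : EnergySpace) : h.toL2C =ᵐ[volume] fun t => (h t : ℂ) := by
  filter_upwards [coeFn_ofRealL (h.memLp.toLp _), h.memLp.coeFn_toLp] with t h1 h2
  rw [toL2C, h1, h2]

theorem coeFn_derivL2C (h : EnergySpace) :
    h.derivL2C =ᵐ[volume] fun t => ((deriv h t : ℝ) : ℂ) := by
  filter_upwards [coeFn_ofRealL (h.memLp_deriv.toLp _), h.memLp_deriv.coeFn_toLp] with t h1 h2
  rw [derivL2C, h1, h2]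

theorem ofRealL_diffOp (h : EnergySpace) :
    ofRealL (diffOp h) = h.derivL2C + (1 / 2 : ℂ) • h.toL2C := by
  refine Lp.ext ?_
  filter_upwards [coeFn_ofRealL (diffOp h), coeFn_diffOp h, coeFn_derivL2C h, coeFn_toL2C h,
    Lp.coeFn_add h.derivL2C ((1 / 2 : ℂ) • h.toL2C), Lp.coeFn_smul (1 / 2 : ℂ) h.toL2C]
    with t h1 h2 h3 h4 h5 h6
  rw [h1, h2, h5, Pi.add_apply, h6, Pi.smul_apply, h3, h4, smul_eq_mul]
  push_cast
  ring

theorem integral_deriv_smul (h : EnergySpace) (φ : 𝓢(ℝ, ℂ)) :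
    ∫ t, deriv φ t * (h t : ℂ) = - ∫ t, φ t * ((deriv h t : ℝ) : ℂ) := by
  have key (L : ℂ →L[ℝ] ℝ) : ∫ t, (L (deriv φ t) * h t + L (φ t) * deriv h t) = 0 := by
    have h1 := integral_mul_deriv (ofSchwartz (φ.postcompCLM (𝕜 := ℝ) L)) h
    have h2 (t : ℝ) : deriv (ofSchwartz (φ.postcompCLM (𝕜 := ℝ) L)) t = L (deriv φ t) :=
      (L.hasFDerivAt.comp_hasDerivAt t (φ.hasDerivAt t)).deriv
    simp_rw [h2] at h1
    exact h1
  have i1 : Integrable (fun t => deriv φ t * (h t : ℂ)) :=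
    ((SchwartzMap.derivCLM ℂ ℂ φ).memLp 2 volume).integrable_mul h.memLp.ofReal
  have i2 : Integrable (fun t => φ t * ((deriv h t : ℝ) : ℂ)) :=
    (φ.memLp 2 volume).integrable_mul h.memLp_deriv.ofReal
  rw [eq_neg_iff_add_eq_zero, ← integral_add i1 i2]
  have i3 := i1.add i2
  apply Complex.ext
  · rw [← RCLike.re_eq_complex_re, ← integral_re (f := fun t => deriv φ t * (h t : ℂ) + φ t * ((deriv h t : ℝ) : ℂ)) i3, map_zero, ← key Complex.reCLM]
    refine integral_congr_ae (.of_forall fun t => ?_)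
    simp
  · rw [← RCLike.im_eq_complex_im, ← integral_im (f := fun t => deriv φ t * (h t : ℂ) + φ t * ((deriv h t : ℝ) : ℂ)) i3, map_zero, ← key Complex.imCLM]
    refine integral_congr_ae (.of_forall fun t => ?_)
    simp

theorem lineDeriv_toL2C (h : EnergySpace) :
    ∂_{(1 : ℝ)} (h.toL2C : 𝓢'(ℝ, ℂ)) = (h.derivL2C : 𝓢'(ℝ, ℂ)) := by
  ext φ
  rw [TemperedDistribution.lineDerivOp_apply_apply, map_neg, Lp.toTemperedDistribution_apply,
    Lp.toTemperedDistribution_apply]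
  have h1 := integral_deriv_smul h φ
  have h2 : ∫ t, (∂_{(1 : ℝ)} φ) t • h.toL2C t = ∫ t, deriv φ t * (h t : ℂ) := by
    refine integral_congr_ae ?_
    filter_upwards [coeFn_toL2C h] with t ht
    rw [ht, smul_eq_mul, SchwartzMap.lineDerivOp_apply_eq_fderiv, fderiv_apply_one_eq_deriv]
  have h3 : ∫ t, φ t • h.derivL2C t = ∫ t, φ t * ((deriv h t : ℝ) : ℂ) := by
    refine integral_congr_ae ?_
    filter_upwards [coeFn_derivL2C h] with t ht
    rw [ht, smul_eq_mul]
  rw [h2, h3, h1, neg_neg]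

theorem fourier_derivL2C (h : EnergySpace) :
    (𝓕 h.derivL2C : L2C) =ᵐ[volume]
      fun ξ => 2 * Real.pi * Complex.I * ξ * (𝓕 h.toL2C : L2C) ξ := by
  have h1 : ((𝓕 h.derivL2C : L2C) : 𝓢'(ℝ, ℂ)) = (2 * Real.pi * Complex.I) •
      TemperedDistribution.smulLeftCLM ℂ (fun x : ℝ => ((inner ℝ x (1 : ℝ) : ℝ) : ℂ))
        ((𝓕 h.toL2C : L2C) : 𝓢'(ℝ, ℂ)) := by
    rw [← Lp.fourier_toTemperedDistribution_eq, ← Lp.fourier_toTemperedDistribution_eq,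
      ← lineDeriv_toL2C, TemperedDistribution.fourier_lineDerivOp_eq]
  have hl1 : LocallyIntegrable (𝓕 h.derivL2C : L2C) volume :=
    (Lp.memLp _).locallyIntegrable (by norm_num)
  have hl2 : LocallyIntegrable (𝓕 h.toL2C : L2C) volume :=
    (Lp.memLp _).locallyIntegrable (by norm_num)
  refine ae_eq_of_integral_contDiff_smul_eq hl1 ?_ ?_
  · exact hl2.continuous_mul (by fun_prop)
  · intro g g_smooth g_cpt
    have hg₁ : HasCompactSupport (Complex.ofRealCLM ∘ g) := g_cpt.comp_left rfl
    have hg₂ : ContDiff ℝ (⊤ : ℕ∞) (Complex.ofRealCLM ∘ g) := by fun_prop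
    have h2 := congrArg (fun T : 𝓢'(ℝ, ℂ) => T (hg₁.toSchwartzMap hg₂)) h1
    have htg : (fun x : ℝ => (x : ℂ)).HasTemperateGrowth := by fun_prop
    have h3 : ∫ x, (g x : ℂ) * (𝓕 h.derivL2C : L2C) x =
        (2 * Real.pi * Complex.I) * ∫ x : ℝ, ((x : ℂ) * (g x : ℂ)) * (𝓕 h.toL2C : L2C) x := by
      simpa [SchwartzMap.smulLeftCLM_apply_apply htg] using h2
    simp only [Complex.real_smul]
    rw [h3, ← integral_const_mul]
    refine integral_congr_ae (.of_forall fun x => ?_)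
    beta_reduce
    ring

theorem fourier_diffOp (h : EnergySpace) :
    (𝓕 (ofRealL (diffOp h)) : L2C) =ᵐ[volume]
      fun ξ => (2 * Real.pi * Complex.I * ξ + 1 / 2) * (𝓕 h.toL2C : L2C) ξ := by
  rw [ofRealL_diffOp, FourierTransform.fourier_add, FourierTransform.fourier_smul]
  filter_upwards [fourier_derivL2C h, Lp.coeFn_add (𝓕 h.derivL2C : L2C) ((1 / 2 : ℂ) • 𝓕 h.toL2C),
    Lp.coeFn_smul (1 / 2 : ℂ) (𝓕 h.toL2C : L2C)] with ξ h1 h2 h3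
  rw [h2, Pi.add_apply, h3, Pi.smul_apply, h1, smul_eq_mul]
  ring

theorem fourier_toL2C_injective :
    Function.Injective fun h : EnergySpace => (𝓕 h.toL2C : L2C) := by
  intro g h hgh
  have h1 := fourier_ofRealL_injective hgh
  rw [MemLp.toLp_eq_toLp_iff] at h1
  have h2 := Measure.eq_of_ae_eq h1 g.continuous h.continuous
  exact ext fun t => congrFun h2 t

theorem exists_flow (u : ℝ) : ∃ O : EnergySpace ≃ₗᵢ[ℝ] EnergySpace,
    ∀ h, (𝓕 (O h).toL2C : L2C) = mulSymbol u (𝓕 h.toL2C) := by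
  refine ⟨(diffEquiv.trans (multEquiv u)).trans diffEquiv.symm, fun h => ?_⟩
  set k := ((diffEquiv.trans (multEquiv u)).trans diffEquiv.symm) h with hk
  have h1 : diffOp k = multR u (diffOp h) := diffEquiv.apply_symm_apply _
  have h2 := fourier_diffOp k
  rw [h1, fourier_multR] at h2
  refine Lp.ext ?_
  filter_upwards [h2, fourier_diffOp h, coeFn_mulSymbol u (𝓕 (ofRealL (diffOp h))),
    coeFn_mulSymbol u (𝓕 h.toL2C)] with ξ h3 h4 h5 h6
  rw [h5, h4] at h3
  rw [h6]
  have h7 : (2 * Real.pi * Complex.I * ξ + 1 / 2 : ℂ) ≠ 0 := by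
    intro h0
    have := congrArg Complex.re h0
    simp at this
  apply mul_left_cancel₀ h7
  rw [← h3]
  ring

/-- There is exactly one orthogonal transformation of `H^U` that multiplies Fourier transforms by
`exp (-2 i u Arctg (2 λ))`. -/
theorem existsUnique_flow (u : ℝ) : ∃! O : EnergySpace ≃ₗᵢ[ℝ] EnergySpace,
    ∀ h, (𝓕 (O h).toL2C : L2C) = mulSymbol u (𝓕 h.toL2C) := by
  obtain ⟨O, hO⟩ := exists_flow u
  refine ⟨O, hO, fun O' hO' => ?_⟩
  refine LinearIsometryEquiv.ext fun h => fourier_toL2C_injective ?_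
  beta_reduce
  rw [hO, hO']

/-- The orthogonal transformation `𝒮ᵘ` of `H^U`: the one that multiplies the Fourier transform
`ĥ(λ) = ∫ exp (-i λ t) h(t) dt` by `exp (-2 i u Arctg (2 λ))`. -/
def flow (u : ℝ) : EnergySpace ≃ₗᵢ[ℝ] EnergySpace := (existsUnique_flow u).choose

/-- Here `ξ = λ / 2π` is the frequency variable of Mathlib's Fourier transform. -/
theorem fourier_flow (u : ℝ) (h : EnergySpace) :
    (𝓕 (flow u h).toL2C : L2C) =ᵐ[volume]
      fun ξ => symbol u (2 * Real.pi * ξ) * (𝓕 h.toL2C : L2C) ξ := by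
  have h1 := (existsUnique_flow u).choose_spec.1 h
  change (𝓕 ((existsUnique_flow u).choose h).toL2C : L2C) =ᵐ[volume] _
  rw [h1]
  exact coeFn_mulSymbol u _

end EnergySpace

/-! ### Abstract Wiener spaces -/

section AbstractWiener

variable {H E : Type*} [NormedAddCommGroup H] [InnerProductSpace ℝ H] [CompleteSpace H]
  [NormedAddCommGroup E] [NormedSpace ℝ E]

/-- `x* ↦ h_{x*}`, where `(h, h_{x*})_H = x* (ι h)` for all `h`. -/
def dualVec (ι : H →L[ℝ] E) : StrongDual ℝ E →ₗ[ℝ] H where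
  toFun x := (InnerProductSpace.toDual ℝ H).symm (x ∘L ι)
  map_add' x y := by rw [ContinuousLinearMap.add_comp, map_add]
  map_smul' c x := by
    rw [ContinuousLinearMap.smul_comp, RingHom.id_apply, map_smulₛₗ]
    rfl

theorem inner_dualVec (ι : H →L[ℝ] E) (x : StrongDual ℝ E) (h : H) :
    ⟪dualVec ι x, h⟫_ℝ = x (ι h) := by
  change ⟪(InnerProductSpace.toDual ℝ H).symm (x ∘L ι), h⟫_ℝ = x (ι h)
  rw [InnerProductSpace.toDual_symm_apply]
  rfl

theorem denseRange_dualVec {ι : H →L[ℝ] E} (hι : Function.Injective ι) : DenseRange (dualVec ι) := by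
  have h1 : (LinearMap.range (dualVec ι)).topologicalClosure = ⊤ := by
    rw [Submodule.topologicalClosure_eq_top_iff, Submodule.eq_bot_iff]
    intro h hh
    have h2 : ∀ x : StrongDual ℝ E, x (ι h) = 0 := fun x => by
      rw [← inner_dualVec]
      exact (Submodule.mem_orthogonal _ _).1 hh _ (LinearMap.mem_range_self _ x)
    have h3 : ι h = 0 := by
      by_contra hne
      obtain ⟨x, -, hx⟩ := exists_dual_vector ℝ (ι h) (norm_ne_zero_iff.2 hne)
      rw [h2] at hx
      exact hne (norm_eq_zero.1 (by exact_mod_cast hx.symm))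
    exact hι (by rw [h3, map_zero])
  have h2 := Submodule.dense_iff_topologicalClosure_eq_top.2 h1
  exact h2

variable [MeasurableSpace E]

/-- `(H, E, W)` is an abstract Wiener space, `H` being embedded in `E` by `ι`. -/
structure IsAbstractWienerSpace (ι : H →L[ℝ] E) (W : Measure E) : Prop where
  separable_left : TopologicalSpace.SeparableSpace H
  separable_right : TopologicalSpace.SeparableSpace E
  injective : Function.Injective ι
  denseRange : DenseRange ι
  isProbabilityMeasure : IsProbabilityMeasure W
  map_dual : ∀ x : StrongDual ℝ E, W.map x = gaussianReal 0 (‖dualVec ι x‖₊ ^ 2)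

namespace IsAbstractWienerSpace

variable [BorelSpace E] {ι : H →L[ℝ] E} {W : Measure E}

theorem memLp_dual (hW : IsAbstractWienerSpace ι W) (x : StrongDual ℝ E) : MemLp x 2 W := by
  have h1 : MemLp id 2 (W.map x) := by
    rw [hW.map_dual]
    exact memLp_id_gaussianReal 2
  exact (memLp_map_measure_iff measurable_id.aestronglyMeasurable
    x.continuous.measurable.aemeasurable).1 h1

/-- `x* ↦ ⟨·, x*⟩ ∈ L²(W)`. -/
def dualToLp (hW : IsAbstractWienerSpace ι W) : StrongDual ℝ E →ₗ[ℝ] Lp ℝ 2 W where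
  toFun x := (hW.memLp_dual x).toLp x
  map_add' x y := by rw [← MemLp.toLp_add]; rfl
  map_smul' c x := by rw [RingHom.id_apply, ← MemLp.toLp_const_smul]; rfl

theorem norm_dualToLp (hW : IsAbstractWienerSpace ι W) (x : StrongDual ℝ E) :
    ‖hW.dualToLp x‖ = ‖dualVec ι x‖ := by
  rw [← sq_eq_sq₀ (norm_nonneg _) (norm_nonneg _), ← real_inner_self_eq_norm_sq, L2.inner_def]
  have h1 : ∫ ω, ⟪hW.dualToLp x ω, hW.dualToLp x ω⟫_ℝ ∂W = ∫ ω, x ω ^ 2 ∂W := by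
    refine integral_congr_ae ?_
    filter_upwards [(hW.memLp_dual x).coeFn_toLp] with ω hω
    have h2 : hW.dualToLp x ω = x ω := hω
    rw [h2, real_inner_self_eq_norm_sq, Real.norm_eq_abs, sq_abs]
  have h3 : ∫ ω, x ω ^ 2 ∂W = ∫ y, y ^ 2 ∂(W.map x) :=
    (integral_map x.continuous.measurable.aemeasurable
      (continuous_pow 2).aestronglyMeasurable).symm
  have h4 := variance_eq_sub (memLp_id_gaussianReal (μ := 0) (v := ‖dualVec ι x‖₊ ^ 2) 2)
  simp only [id, Pi.pow_apply] at h4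
  rw [variance_id_gaussianReal, integral_id_gaussianReal] at h4
  rw [h1, h3, hW.map_dual]
  simpa using h4.symm

theorem extend_dualVec (hW : IsAbstractWienerSpace ι W) (x : StrongDual ℝ E) :
    hW.dualToLp.extendOfNorm (dualVec ι) (dualVec ι x) = hW.dualToLp x :=
  LinearMap.extendOfNorm_eq (denseRange_dualVec hW.injective)
    ⟨1, fun y => by rw [one_mul, norm_dualToLp]⟩ x

/-- The Paley–Wiener map: the isometry `H → L²(W)` that maps `h_{x*}` to `⟨·, x*⟩`. -/
def paleyWiener (hW : IsAbstractWienerSpace ι W) : H →ₗᵢ[ℝ] Lp ℝ 2 W where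
  toLinearMap := (hW.dualToLp.extendOfNorm (dualVec ι)).toLinearMap
  norm_map' h := by
    refine (denseRange_dualVec hW.injective).induction_on
      (p := fun h => ‖hW.dualToLp.extendOfNorm (dualVec ι) h‖ = ‖h‖) h ?_ ?_
    · exact isClosed_eq (ContinuousLinearMap.continuous _).norm continuous_norm
    · intro x
      rw [extend_dualVec, norm_dualToLp]

theorem paleyWiener_dualVec (hW : IsAbstractWienerSpace ι W) (x : StrongDual ℝ E) :
    hW.paleyWiener (dualVec ι x) =ᵐ[W] x := by
  change hW.dualToLp.extendOfNorm (dualVec ι) (dualVec ι x) =ᵐ[W] x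
  rw [extend_dualVec]
  exact (hW.memLp_dual x).coeFn_toLp

/-- `T` is (a version of) the transformation `T_O` of `E` associated with the orthogonal
transformation `O` of `H`: for each `h`, `I(h) ∘ T = I(Oᵀ h)` almost surely. As `I(h)` is only
defined up to null sets, every version `f` of `I(h)` is considered; `Oᵀ = O⁻¹`. -/
structure IsTransform (hW : IsAbstractWienerSpace ι W) (O : H ≃ₗᵢ[ℝ] H) (T : E → E) : Prop where
  aemeasurable : AEMeasurable T W
  comp_ae_eq : ∀ (h : H) (f : E → ℝ), f =ᵐ[W] hW.paleyWiener h →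
    f ∘ T =ᵐ[W] hW.paleyWiener (O.symm h)

end IsAbstractWienerSpace

end AbstractWiener

/-- `(X_t)` is a standard stationary Ornstein–Uhlenbeck process: continuous, centred, Gaussian, with
covariance `exp (-|t - s| / 2)`. -/
structure IsOrnsteinUhlenbeck {Ω : Type*} [MeasurableSpace Ω] (X : ℝ → Ω → ℝ) (P : Measure Ω) :
    Prop where
  isGaussianProcess : IsGaussianProcess X P
  centered : ∀ t, ∫ ω, X t ω ∂P = 0
  covariance : ∀ s t, ∫ ω, X s ω * X t ω ∂P = Real.exp (-|t - s| / 2)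
  continuous_paths : ∀ᵐ ω ∂P, Continuous fun t => X t ω

end

end WienerFlow

open WienerFlow

/-!
Let `I` be the Paley–Wiener isometry of an abstract Wiener space. Every `I(h)` is a centred
Gaussian variable of variance `‖h‖²` (`IsAbstractWienerSpace.map_paleyWiener`: true for `h` in
the dense range of `dualVec`, and the characteristic function at a fixed point is continuous on
`L²`). Hence families `(I(h_i))` are Gaussian, and their joint laws depend on the Gram matrix of
the `h_i` only (`IsAbstractWienerSpace.identDistrib_of_inner_eq`). In particular an orthogonal
`O` of `H` does not change the law of a countable separating family of functionals, which is a
Borel embedding of the path space into a product of lines; pulling back along that embedding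
gives a measure preserving transformation associated with `O`
(`IsAbstractWienerSpace.exists_isTransform`).

For the flow, evaluation at `t` is represented in `H^U` by the two-sided exponential `kernel t`,
so that `Sᵘω(t) = I(flowKernel u t)` almost surely, with `flowKernel u t = (𝒮ᵘ)⁻¹ (kernel t)`.
Everything else is a statement about inner products of these vectors. Plancherel's theorem and
the explicit Fourier transform of the kernel give the covariance
(`EnergySpace.inner_flowKernel`), which depends on differences of the parameters only; for equal
flow times it is `⟪kernel s, kernel t⟫`, that is, `exp (-|t - s| / 2)`. As `|Arctg| ≤ π / 2`,
changing the flow time changes the covariance by at most `π |u - v|`, so that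
`|1 - ⟪flowKernel u s, flowKernel v t⟫| ≤ π |u - v| + |t - s| / 2`
(`EnergySpace.abs_one_sub_inner_flowKernel_le`), a bound without the logarithm. Consequently
sixth moments of increments are of the order of the third power of the distance, and a Kolmogorov
criterion in the plane (`exists_continuous_modification`) gives the jointly continuous version.
-/

namespace WienerFlow

/-! ### The Gaussian family of Paley–Wiener integrals -/

theorem norm_exp_I_mul_ofReal_sub_exp_le (x y : ℝ) :
    ‖Complex.exp (Complex.I * x) - Complex.exp (Complex.I * y)‖ ≤ |x - y| := by
  have h1 : Complex.exp (Complex.I * x) - Complex.exp (Complex.I * y) =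
      Complex.exp (Complex.I * y) * (Complex.exp (Complex.I * (x - y : ℝ)) - 1) := by
    rw [mul_sub, ← Complex.exp_add, mul_one]
    congr 2; push_cast; ring
  rw [h1, norm_mul, mul_comm Complex.I (y : ℂ), Complex.norm_exp_ofReal_mul_I, one_mul]
  exact Real.norm_exp_I_mul_ofReal_sub_one_le

/-- The characteristic function at `1` of the law of `f` is Lipschitz in `f ∈ L²`. -/
theorem continuous_integral_exp_Lp {Ω : Type*} [MeasurableSpace Ω] (P : Measure Ω)
    [IsProbabilityMeasure P] :
    Continuous fun f : Lp ℝ 2 P => ∫ ω, Complex.exp (Complex.I * (f ω : ℝ)) ∂P := by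
  have hint (f : Lp ℝ 2 P) : Integrable (fun ω => Complex.exp (Complex.I * (f ω : ℝ))) P := by
    refine Integrable.of_bound (C := 1) ?_ (.of_forall fun ω => ?_)
    · exact (by fun_prop : Continuous fun x : ℝ =>
        Complex.exp (Complex.I * x)).comp_aestronglyMeasurable (Lp.aestronglyMeasurable f)
    · rw [mul_comm, Complex.norm_exp_ofReal_mul_I]
  refine (LipschitzWith.of_dist_le_mul (K := 1) fun f g => ?_).continuous
  rw [dist_eq_norm, dist_eq_norm, ← integral_sub (hint f) (hint g), NNReal.coe_one, one_mul]
  have hfg : MemLp (f - g) 2 P := Lp.memLp _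
  have h1 : ∫ ω, |(f - g : Lp ℝ 2 P) ω| ∂P ≤ ‖f - g‖ := by
    have h2 := eLpNorm_le_eLpNorm_of_exponent_le (p := 1) (q := 2) (by norm_num)
      hfg.aestronglyMeasurable
    rw [eLpNorm_one_eq_lintegral_enorm] at h2
    rw [Lp.norm_def]
    have h3 := ENNReal.toReal_mono hfg.eLpNorm_ne_top h2
    rwa [← integral_norm_eq_lintegral_enorm hfg.aestronglyMeasurable] at h3
  refine (norm_integral_le_integral_norm _).trans (le_trans ?_ h1)
  refine integral_mono_ae ((hint f).sub (hint g)).norm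
    (hfg.integrable (by norm_num)).abs ?_
  filter_upwards [Lp.coeFn_sub f g] with ω hω
  rw [hω, Pi.sub_apply]
  exact norm_exp_I_mul_ofReal_sub_exp_le _ _

theorem span_dualVec_topologicalClosure_eq_top {H E : Type*} [NormedAddCommGroup H]
    [InnerProductSpace ℝ H] [CompleteSpace H] [NormedAddCommGroup E] [NormedSpace ℝ E]
    {ι : H →L[ℝ] E} (hι : Function.Injective ι) {κ : Type*}
    (x : κ → StrongDual ℝ E) (hx : ∀ ω, (∀ i, x i ω = 0) → ω = 0) :
    (Submodule.span ℝ (Set.range fun i => dualVec ι (x i))).topologicalClosure = ⊤ := by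
  rw [Submodule.topologicalClosure_eq_top_iff, Submodule.eq_bot_iff]
  intro h hh
  have h2 : ι h = 0 := hx _ fun i => by
    rw [← inner_dualVec]
    exact (Submodule.mem_orthogonal _ _).1 hh _ (Submodule.subset_span (Set.mem_range_self i))
  exact hι (by rw [h2, map_zero])

namespace IsAbstractWienerSpace

variable {H E : Type*} [NormedAddCommGroup H] [InnerProductSpace ℝ H] [CompleteSpace H]
  [NormedAddCommGroup E] [NormedSpace ℝ E] [MeasurableSpace E] [BorelSpace E]
  {ι : H →L[ℝ] E} {W : Measure E}

theorem integral_exp_paleyWiener (hW : IsAbstractWienerSpace ι W) (h : H) :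
    ∫ ω, Complex.exp (Complex.I * (hW.paleyWiener h ω : ℝ)) ∂W =
      Complex.exp (-(‖h‖ ^ 2 / 2 : ℝ)) := by
  have := hW.isProbabilityMeasure
  refine (denseRange_dualVec hW.injective).induction_on
    (p := fun h => ∫ ω, Complex.exp (Complex.I * (hW.paleyWiener h ω : ℝ)) ∂W =
      Complex.exp (-(‖h‖ ^ 2 / 2 : ℝ))) h ?_ fun x => ?_
  · exact isClosed_eq ((continuous_integral_exp_Lp W).comp hW.paleyWiener.continuous)
      (by fun_prop)
  · have h1 := charFun_gaussianReal (μ := 0) (v := ‖dualVec ι x‖₊ ^ 2) 1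
    rw [← hW.map_dual, charFun_apply_real, integral_map x.continuous.measurable.aemeasurable
      (by fun_prop)] at h1
    calc _ = ∫ ω, Complex.exp ((1 : ℝ) * (x ω : ℝ) * Complex.I) ∂W := by
          refine integral_congr_ae ?_
          filter_upwards [hW.paleyWiener_dualVec x] with ω hω
          rw [hω, Complex.ofReal_one, one_mul, mul_comm]
      _ = _ := by
          rw [h1]
          congr 1
          simp

/-- `I(h)` is a centred Gaussian variable with variance `‖h‖²`, for every `h ∈ H`. -/
theorem map_paleyWiener (hW : IsAbstractWienerSpace ι W) (h : H) :
    W.map (hW.paleyWiener h) = gaussianReal 0 (‖h‖₊ ^ 2) := by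
  have := hW.isProbabilityMeasure
  have hm : AEMeasurable (hW.paleyWiener h) W := (Lp.aestronglyMeasurable _).aemeasurable
  have := Measure.isProbabilityMeasure_map hm
  refine Measure.ext_of_charFun (funext fun t => ?_)
  rw [charFun_gaussianReal, charFun_apply_real, integral_map hm (by fun_prop)]
  have h1 := hW.integral_exp_paleyWiener (t • h)
  rw [map_smul] at h1
  calc _ = _ := integral_congr_ae ?_
    _ = _ := h1
    _ = _ := ?_
  · filter_upwards [Lp.coeFn_smul t (hW.paleyWiener h)] with ω hω
    rw [hω, Pi.smul_apply, smul_eq_mul]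
    congr 1; push_cast; ring
  · congr 1
    rw [norm_smul, mul_pow, Real.norm_eq_abs, sq_abs]
    push_cast
    simp
    ring

theorem memLp_of_ae_eq (hW : IsAbstractWienerSpace ι W) {X : E → ℝ} {g : H}
    (hX : X =ᵐ[W] hW.paleyWiener g) : MemLp X 2 W :=
  (Lp.memLp (hW.paleyWiener g)).ae_eq hX.symm

theorem integral_mul_of_ae_eq (hW : IsAbstractWienerSpace ι W) {X Y : E → ℝ} {g h : H}
    (hX : X =ᵐ[W] hW.paleyWiener g) (hY : Y =ᵐ[W] hW.paleyWiener h) :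
    ∫ ω, X ω * Y ω ∂W = ⟪g, h⟫_ℝ := by
  rw [← hW.paleyWiener.inner_map_map, L2.inner_def]
  refine integral_congr_ae ?_
  filter_upwards [hX, hY] with ω h1 h2
  rw [h1, h2]
  exact mul_comm _ _

theorem map_of_ae_eq (hW : IsAbstractWienerSpace ι W) {X : E → ℝ} {g : H}
    (hX : X =ᵐ[W] hW.paleyWiener g) : W.map X = gaussianReal 0 (‖g‖₊ ^ 2) := by
  rw [Measure.map_congr hX, map_paleyWiener]

theorem integral_of_ae_eq (hW : IsAbstractWienerSpace ι W) {X : E → ℝ} {g : H}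
    (hX : X =ᵐ[W] hW.paleyWiener g) : ∫ ω, X ω ∂W = 0 := by
  have h1 : ∫ y, y ∂(W.map X) = 0 := by rw [hW.map_of_ae_eq hX, integral_id_gaussianReal]
  rwa [integral_map (hW.memLp_of_ae_eq hX).aestronglyMeasurable.aemeasurable (by fun_prop)] at h1

theorem sum_smul_ae_eq (hW : IsAbstractWienerSpace ι W) {κ : Type*} {X : κ → E → ℝ}
    {g : κ → H} (hX : ∀ i, X i =ᵐ[W] hW.paleyWiener (g i)) (c : κ → ℝ) (s : Finset κ) :
    (fun ω => ∑ i ∈ s, X i ω * c i) =ᵐ[W] hW.paleyWiener (∑ i ∈ s, c i • g i) := by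
  classical
  induction s using Finset.induction_on with
  | empty =>
    simp only [Finset.sum_empty, map_zero]
    exact (Lp.coeFn_zero ℝ 2 W).symm
  | insert i s hi ih =>
    simp only [Finset.sum_insert hi, map_add, map_smul]
    filter_upwards [ih, hX i, Lp.coeFn_smul (c i) (hW.paleyWiener (g i)),
      Lp.coeFn_add (c i • hW.paleyWiener (g i)) (hW.paleyWiener (∑ i ∈ s, c i • g i))]
      with ω h1 h2 h3 h4
    rw [h4, Pi.add_apply, h3, Pi.smul_apply, h1, h2, smul_eq_mul, mul_comm]

/-- Every linear combination of Paley–Wiener integrals is again one, of the combined integrand. -/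
theorem map_dual_of_ae_eq (hW : IsAbstractWienerSpace ι W) {κ : Type*} [Fintype κ]
    {X : κ → E → ℝ} {g : κ → H} (hX : ∀ i, X i =ᵐ[W] hW.paleyWiener (g i))
    (L : StrongDual ℝ (κ → ℝ)) :
    (W.map fun ω i => X i ω).map L =
      gaussianReal 0 (‖∑ i, L (Pi.basisFun ℝ κ i) • g i‖₊ ^ 2) := by
  have hm : AEMeasurable (fun ω i => X i ω) W :=
    aemeasurable_pi_lambda _ fun i => (hW.memLp_of_ae_eq (hX i)).aestronglyMeasurable.aemeasurable
  rw [AEMeasurable.map_map_of_aemeasurable L.continuous.measurable.aemeasurable hm]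
  refine hW.map_of_ae_eq ?_
  refine EventuallyEq.trans (.of_forall fun ω => ?_) (hW.sum_smul_ae_eq hX _ _)
  have h1 := (Pi.basisFun ℝ κ).sum_repr fun i => X i ω
  change L (fun i => X i ω) = _
  rw [← h1, map_sum]
  simp only [map_smul, Pi.basisFun_repr, smul_eq_mul]

theorem hasGaussianLaw_of_ae_eq (hW : IsAbstractWienerSpace ι W) {κ : Type*} [Fintype κ]
    {X : κ → E → ℝ} {g : κ → H} (hX : ∀ i, X i =ᵐ[W] hW.paleyWiener (g i)) :
    HasGaussianLaw (fun ω i => X i ω) W :=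
  ⟨isGaussian_of_map_eq_gaussianReal fun L => ⟨_, _, hW.map_dual_of_ae_eq hX L⟩⟩

theorem isGaussianProcess_of_ae_eq (hW : IsAbstractWienerSpace ι W) {κ : Type*}
    {X : κ → E → ℝ} {g : κ → H} (hX : ∀ i, X i =ᵐ[W] hW.paleyWiener (g i)) :
    IsGaussianProcess X W :=
  ⟨fun I => hW.hasGaussianLaw_of_ae_eq (κ := I) fun i => hX i⟩

/-- The joint law of Paley–Wiener integrals is determined by the Gram matrix of the integrands. -/
theorem identDistrib_of_inner_eq_fintype (hW : IsAbstractWienerSpace ι W) {κ : Type*} [Fintype κ]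
    {X X' : κ → E → ℝ} {g g' : κ → H} (hX : ∀ i, X i =ᵐ[W] hW.paleyWiener (g i))
    (hX' : ∀ i, X' i =ᵐ[W] hW.paleyWiener (g' i)) (hg : ∀ i j, ⟪g i, g j⟫_ℝ = ⟪g' i, g' j⟫_ℝ) :
    IdentDistrib (fun ω i => X i ω) (fun ω i => X' i ω) W W := by
  have := hW.isProbabilityMeasure
  have hm : AEMeasurable (fun ω i => X i ω) W :=
    aemeasurable_pi_lambda _ fun i => (hW.memLp_of_ae_eq (hX i)).aestronglyMeasurable.aemeasurable
  have hm' : AEMeasurable (fun ω i => X' i ω) W :=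
    aemeasurable_pi_lambda _ fun i => (hW.memLp_of_ae_eq (hX' i)).aestronglyMeasurable.aemeasurable
  have := Measure.isProbabilityMeasure_map hm
  have := Measure.isProbabilityMeasure_map hm'
  refine ⟨hm, hm', Measure.ext_of_charFunDual (funext fun L => ?_)⟩
  have hn : ‖∑ i, L (Pi.basisFun ℝ κ i) • g i‖₊ = ‖∑ i, L (Pi.basisFun ℝ κ i) • g' i‖₊ := by
    rw [← NNReal.coe_inj, coe_nnnorm, coe_nnnorm, ← sq_eq_sq₀ (norm_nonneg _) (norm_nonneg _),
      ← real_inner_self_eq_norm_sq, ← real_inner_self_eq_norm_sq]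
    simp_rw [sum_inner, inner_sum, inner_smul_left, inner_smul_right, hg]
  rw [charFunDual_eq_charFun_map_one, charFunDual_eq_charFun_map_one, hW.map_dual_of_ae_eq hX,
    hW.map_dual_of_ae_eq hX', hn]

theorem identDistrib_of_inner_eq (hW : IsAbstractWienerSpace ι W) {κ : Type*} [Countable κ]
    {X X' : κ → E → ℝ} {g g' : κ → H} (hX : ∀ i, X i =ᵐ[W] hW.paleyWiener (g i))
    (hX' : ∀ i, X' i =ᵐ[W] hW.paleyWiener (g' i)) (hg : ∀ i j, ⟪g i, g j⟫_ℝ = ⟪g' i, g' j⟫_ℝ) :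
    IdentDistrib (fun ω i => X i ω) (fun ω i => X' i ω) W W := by
  have := hW.isProbabilityMeasure
  refine (identDistrib_iff_forall_finset_identDistrib (𝓧 := fun _ => ℝ) ?_ ?_).2 fun I => ?_
  · exact aemeasurable_pi_lambda _ fun i =>
      (hW.memLp_of_ae_eq (hX i)).aestronglyMeasurable.aemeasurable
  · exact aemeasurable_pi_lambda _ fun i =>
      (hW.memLp_of_ae_eq (hX' i)).aestronglyMeasurable.aemeasurable
  · exact hW.identDistrib_of_inner_eq_fintype (κ := I) (fun i => hX i) (fun i => hX' i)
      fun i j => hg i j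

/-! ### Existence of the transformation associated with an orthogonal map -/

/-- A measure preserving map that transforms a separating family of functionals in the right way is
associated with `O`: both sides of `I(h) ∘ T = I(O⁻¹ h)` are isometries in `h`, and the vectors that
represent the functionals span a dense subspace. -/
theorem isTransform_of_measurePreserving (hW : IsAbstractWienerSpace ι W) (O : H ≃ₗᵢ[ℝ] H)
    {κ : Type*} (x : κ → StrongDual ℝ E) (hx : ∀ ω, (∀ i, x i ω = 0) → ω = 0) {T : E → E}
    (hT : MeasurePreserving T W W)
    (hxT : ∀ i, x i ∘ T =ᵐ[W] hW.paleyWiener (O.symm (dualVec ι (x i)))) :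
    hW.IsTransform O T := by
  have key : (Lp.compMeasurePreservingₗᵢ ℝ T hT).toContinuousLinearMap ∘L
        hW.paleyWiener.toContinuousLinearMap =
      hW.paleyWiener.toContinuousLinearMap ∘L
        (O.symm.toLinearIsometry.toContinuousLinearMap : H →L[ℝ] H) := by
    refine ContinuousLinearMap.ext_on (s := Set.range fun i => dualVec ι (x i)) ?_ ?_
    · exact Submodule.dense_iff_topologicalClosure_eq_top.2
        (span_dualVec_topologicalClosure_eq_top hW.injective x hx)
    · rintro _ ⟨i, rfl⟩
      refine Lp.ext ?_
      exact ((Lp.coeFn_compMeasurePreserving _ hT).trans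
        (hT.quasiMeasurePreserving.ae_eq_comp (hW.paleyWiener_dualVec (x i)))).trans (hxT i)
  refine ⟨hT.measurable.aemeasurable, fun h f hf => ?_⟩
  have h1 : Lp.compMeasurePreserving T hT (hW.paleyWiener h) = hW.paleyWiener (O.symm h) :=
    congrArg (fun A : H →L[ℝ] Lp ℝ 2 W => A h) key
  rw [← h1]
  exact (hT.quasiMeasurePreserving.ae_eq_comp hf).trans (Lp.coeFn_compMeasurePreserving _ hT).symm

/-- Existence of the transformation associated with `O`. Evaluation along a countable separating
family is a Borel embedding of `E` into a product of lines (Lusin–Souslin), and the Paley–Wiener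
integrals of the rotated vectors have the law of that family; hence they almost surely
take values in the image of `E`, and can be pulled back. -/
theorem exists_isTransform (hW : IsAbstractWienerSpace ι W) [CompleteSpace E] (O : H ≃ₗᵢ[ℝ] H)
    {κ : Type*} [Countable κ] (x : κ → StrongDual ℝ E) (hx : ∀ ω, (∀ i, x i ω = 0) → ω = 0) :
    ∃ T : E → E, hW.IsTransform O T := by
  have := hW.isProbabilityMeasure
  have := hW.separable_right
  have : SecondCountableTopology E := UniformSpace.secondCountable_of_separable E
  set R : E → κ → ℝ := fun ω i => x i ω with hR
  have hRc : Continuous R := continuous_pi fun i => (x i).continuous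
  have hRi : Function.Injective R := fun ω η h => by
    rw [← sub_eq_zero]
    refine hx _ fun i => ?_
    rw [map_sub, sub_eq_zero]
    exact congrFun h i
  have hRe : MeasurableEmbedding R := hRc.measurableEmbedding hRi
  have hm (i : κ) : AEMeasurable (hW.paleyWiener (O.symm (dualVec ι (x i)))) W :=
    (Lp.aestronglyMeasurable _).aemeasurable
  set X : E → κ → ℝ := fun ω i => (hm i).mk _ ω with hXdef
  have hXm : Measurable X := measurable_pi_lambda _ fun i => (hm i).measurable_mk
  have hX (i : κ) : (fun ω => X ω i) =ᵐ[W] hW.paleyWiener (O.symm (dualVec ι (x i))) :=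
    (hm i).ae_eq_mk.symm
  have hlaw : W.map X = W.map R :=
    (hW.identDistrib_of_inner_eq hX (fun i => (hW.paleyWiener_dualVec (x i)).symm)
      fun i j => O.symm.inner_map_map _ _).map_eq
  -- the range of `R` is Borel and has full measure for the common law of `X` and `R`
  have hmem : ∀ᵐ ω ∂W, X ω ∈ Set.range R := by
    have h1 : ∀ᵐ y ∂(W.map R), y ∈ Set.range R :=
      (ae_map_iff hRc.measurable.aemeasurable hRe.measurableSet_range).2
        (.of_forall fun ω => Set.mem_range_self ω)
    rw [← hlaw] at h1
    exact ae_of_ae_map hXm.aemeasurable h1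
  obtain ⟨G, hGm, hG⟩ : ∃ G : (κ → ℝ) → E, Measurable G ∧ ∀ ω, G (R ω) = ω :=
    hRe.exists_measurable_extend measurable_id (fun _ => ⟨0⟩) |>.imp fun G h =>
      ⟨h.1, fun ω => congrFun h.2 ω⟩
  have hRG : ∀ᵐ ω ∂W, R (G (X ω)) = X ω := by
    filter_upwards [hmem] with ω hω
    obtain ⟨η, hη⟩ := hω
    rw [← hη, hG]
  have hTm : Measurable (G ∘ X) := hGm.comp hXm
  refine ⟨G ∘ X, hW.isTransform_of_measurePreserving O x hx ⟨hTm, ?_⟩ fun i => ?_⟩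
  · rw [← Measure.map_map hGm hXm, hlaw, Measure.map_map hGm hRc.measurable]
    have : G ∘ R = id := funext hG
    rw [this, Measure.map_id]
  · filter_upwards [hRG, hX i] with ω h1 h2
    rw [← h2, ← h1]
    rfl

theorem IsTransform.dual_comp_ae_eq {hW : IsAbstractWienerSpace ι W} {O : H ≃ₗᵢ[ℝ] H} {T : E → E}
    (hT : hW.IsTransform O T) (x : StrongDual ℝ E) :
    (fun ω => x (T ω)) =ᵐ[W] hW.paleyWiener (O.symm (dualVec ι x)) :=
  hT.comp_ae_eq _ _ (hW.paleyWiener_dualVec x).symm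

end IsAbstractWienerSpace

end WienerFlow

namespace WienerFlow

/-! ### Evaluation functionals and the reproducing kernel of `H^U` -/

theorem PathSpace.abs_apply_le (ω : PathSpace) (t : ℝ) : |ω t| ≤ logWeight t * ‖ω‖ := by
  have h1 : ‖PathSpace.toC0 ω t‖ ≤ ‖PathSpace.toC0 ω‖ :=
    (PathSpace.toC0 ω).toBCF.norm_coe_le_norm t
  have h2 : PathSpace.toC0 ω t = ω t / logWeight t := rfl
  rw [PathSpace.norm_toC0, h2, norm_div, Real.norm_eq_abs, Real.norm_eq_abs,
    abs_of_pos (logWeight_pos t), div_le_iff₀ (logWeight_pos t)] at h1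
  linarith

/-- Evaluation at `t`, as a continuous linear functional on `𝒰`. -/
noncomputable def PathSpace.eval (t : ℝ) : StrongDual ℝ PathSpace :=
  LinearMap.mkContinuous
    { toFun := fun ω => ω t
      map_add' := fun _ _ => rfl
      map_smul' := fun _ _ => rfl } (logWeight t) fun ω => ω.abs_apply_le t

theorem PathSpace.eq_zero_of_eval_rat {ω : PathSpace} (h : ∀ q : ℚ, PathSpace.eval q ω = 0) :
    ω = 0 := by
  have h1 : (ω : ℝ → ℝ) = fun _ => 0 :=
    Continuous.ext_on (s := Set.range ((↑) : ℚ → ℝ)) Rat.denseRange_cast ω.continuous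
      continuous_const (by rintro _ ⟨q, rfl⟩; exact h q)
  exact PathSpace.ext fun t => congrFun h1 t

theorem integrable_exp_neg_mul_abs_sub {a : ℝ} (ha : 0 < a) (t : ℝ) :
    Integrable fun s : ℝ => Real.exp (-a * |s - t|) := by
  rw [← integrableOn_univ, ← Set.Iic_union_Ioi (a := t), integrableOn_union]
  constructor
  · refine ((integrableOn_exp_mul_Iic ha t).const_mul (Real.exp (-a * t))).congr
      ((ae_restrict_iff' measurableSet_Iic).2 (.of_forall fun s hs => ?_))
    beta_reduce
    rw [← Real.exp_add, abs_of_nonpos (sub_nonpos.2 hs)]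
    congr 1; ring
  · refine ((integrableOn_exp_mul_Ioi (neg_lt_zero.2 ha) t).const_mul (Real.exp (a * t))).congr
      ((ae_restrict_iff' measurableSet_Ioi).2 (.of_forall fun s hs => ?_))
    beta_reduce
    rw [← Real.exp_add, abs_of_pos (sub_pos.2 hs)]
    congr 1; ring

theorem lipschitzWith_exp_neg_half_abs_sub (t : ℝ) :
    LipschitzWith 1 fun s : ℝ => Real.exp (-(1 / 2) * |s - t|) := by
  refine LipschitzWith.of_dist_le_mul fun x y => ?_
  have h1 := (convex_Iic (0 : ℝ)).norm_image_sub_le_of_norm_deriv_le (f := Real.exp) (C := 1)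
    (fun x _ => Real.differentiableAt_exp)
    (fun x hx => by
      rw [Real.deriv_exp, Real.norm_eq_abs, Real.abs_exp]; exact Real.exp_le_one_iff.2 hx)
    (x := -(1 / 2) * |y - t|) (y := -(1 / 2) * |x - t|)
    (by simp) (by simp)
  rw [NNReal.coe_one, one_mul, Real.dist_eq, Real.dist_eq]
  rw [Real.norm_eq_abs, Real.norm_eq_abs, one_mul] at h1
  refine h1.trans ?_
  rw [← mul_sub, abs_mul]
  have h2 := abs_abs_sub_abs_le_abs_sub (x - t) (y - t)
  rw [sub_sub_sub_cancel_right] at h2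
  have h3 : |(-(1 / 2) : ℝ)| ≤ 1 := by norm_num
  nlinarith [abs_nonneg (|x - t| - |y - t|)]

theorem hasDerivAt_exp_neg_half_abs_sub_of_lt {s t : ℝ} (h : s < t) :
    HasDerivAt (fun s : ℝ => Real.exp (-(1 / 2) * |s - t|))
      (1 / 2 * Real.exp (-(1 / 2) * |s - t|)) s := by
  have h1 : HasDerivAt (fun s : ℝ => -(1 / 2) * |s - t|) (1 / 2) s := by
    simpa using ((hasDerivAt_abs_neg (sub_neg.2 h)).comp s
      ((hasDerivAt_id s).sub_const t)).const_mul (-(1 / 2) : ℝ)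
  simpa [mul_comm] using h1.exp

theorem hasDerivAt_exp_neg_half_abs_sub_of_gt {s t : ℝ} (h : t < s) :
    HasDerivAt (fun s : ℝ => Real.exp (-(1 / 2) * |s - t|))
      (-(1 / 2) * Real.exp (-(1 / 2) * |s - t|)) s := by
  have h1 : HasDerivAt (fun s : ℝ => -(1 / 2) * |s - t|) (-(1 / 2)) s := by
    simpa using ((hasDerivAt_abs_pos (sub_pos.2 h)).comp s
      ((hasDerivAt_id s).sub_const t)).const_mul (-(1 / 2) : ℝ)
  simpa [mul_comm] using h1.exp

namespace EnergySpace

/-- The two-sided exponential `s ↦ exp (-|s - t| / 2)`, as an element of `H^U`. -/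
noncomputable def kernel (t : ℝ) : EnergySpace :=
  ⟨fun s => Real.exp (-(1 / 2) * |s - t|),
    fun _ _ =>
      (lipschitzWith_exp_neg_half_abs_sub t).lipschitzOnWith.absolutelyContinuousOnInterval,
    by
      have h1 : MemLp (fun s => Real.exp (-(1 / 2) * |s - t|)) 2 volume := by
        rw [memLp_two_iff_integrable_sq (by fun_prop)]
        refine (integrable_exp_neg_mul_abs_sub one_pos t).congr (.of_forall fun s => ?_)
        beta_reduce
        rw [← Real.exp_nat_mul]
        congr 1; push_cast; ring
      refine ⟨h1, h1.of_le (measurable_deriv _).aestronglyMeasurable ?_⟩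
      filter_upwards [Measure.ae_ne volume t] with s hs
      have h0 := Real.exp_pos (-(1 / 2) * |s - t|)
      rcases lt_or_gt_of_ne hs with h | h
      · rw [(hasDerivAt_exp_neg_half_abs_sub_of_lt h).deriv, Real.norm_eq_abs, Real.norm_eq_abs,
          abs_of_pos h0, abs_of_pos (by positivity)]
        linarith
      · rw [(hasDerivAt_exp_neg_half_abs_sub_of_gt h).deriv, Real.norm_eq_abs, Real.norm_eq_abs,
          abs_of_pos h0, neg_mul, abs_neg, abs_of_pos (by positivity)]
        linarith⟩

theorem kernel_apply (t s : ℝ) : kernel t s = Real.exp (-(1 / 2) * |s - t|) := rfl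

/-- The reproducing property: on either side of `t` the integrand is `± (kernel · h)' / 2`. -/
theorem inner_kernel (t : ℝ) (h : EnergySpace) : ⟪kernel t, h⟫_ℝ = h t := by
  have hi := integrable_energy (kernel t) h
  have hne : ∀ᵐ s : ℝ, s ≠ t := Measure.ae_ne volume t
  rw [inner_eq, ← intervalIntegral.integral_Iic_add_Ioi (b := t) hi.integrableOn hi.integrableOn]
  have h1 : ∫ s in Set.Iic t, (1 / 4 * (kernel t s * h s) + deriv (kernel t) s * deriv h s) =
      ∫ s in Set.Iic t, 1 / 2 * (deriv (kernel t) s * h s + kernel t s * deriv h s) := by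
    refine setIntegral_congr_ae measurableSet_Iic ?_
    filter_upwards [hne] with s hs hst
    have h2 : deriv (kernel t) s = 1 / 2 * kernel t s :=
      (hasDerivAt_exp_neg_half_abs_sub_of_lt (lt_of_le_of_ne hst hs)).deriv
    rw [h2]; ring
  have h3 : ∫ s in Set.Ioi t, (1 / 4 * (kernel t s * h s) + deriv (kernel t) s * deriv h s) =
      ∫ s in Set.Ioi t, -(1 / 2) * (deriv (kernel t) s * h s + kernel t s * deriv h s) := by
    refine setIntegral_congr_fun measurableSet_Ioi fun s hs => ?_
    have h2 : deriv (kernel t) s = -(1 / 2) * kernel t s :=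
      (hasDerivAt_exp_neg_half_abs_sub_of_gt hs).deriv
    rw [h2]; ring
  rw [h1, h3, integral_const_mul, integral_const_mul, integral_Iic_mul_deriv,
    integral_Ioi_mul_deriv]
  have h4 : kernel t t = 1 := by simp [kernel_apply]
  rw [h4]; ring

theorem dualVec_eval (t : ℝ) : dualVec toPath (PathSpace.eval t) = kernel t :=
  ext_inner_right ℝ fun h => by rw [inner_dualVec, inner_kernel]; rfl

theorem inner_kernel_kernel (s t : ℝ) : ⟪kernel s, kernel t⟫_ℝ = Real.exp (-|t - s| / 2) := by
  rw [inner_kernel, kernel_apply, abs_sub_comm]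
  congr 1; ring

end EnergySpace

/-! ### The covariance in Fourier variables -/

/-- On `L¹ ∩ L²` the `L²` Fourier transform is given by the Fourier integral. -/
theorem fourier_toLp_ae_eq {f : ℝ → ℂ} (hf : MemLp f 2 volume) (hf1 : Integrable f volume) :
    (𝓕 (hf.toLp f) : L2C) =ᵐ[volume] 𝓕 f := by
  have hc : Continuous (𝓕 f) := VectorFourier.fourierIntegral_continuous Real.continuous_fourierChar
    (by exact continuous_inner) hf1
  have h1 := Lp.fourier_toTemperedDistribution_eq (hf.toLp f)
  refine ae_eq_of_integral_contDiff_smul_eq ((Lp.memLp _).locallyIntegrable (by norm_num))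
    hc.locallyIntegrable ?_
  intro g g_smooth g_cpt
  have hg₁ : HasCompactSupport (Complex.ofRealCLM ∘ g) := g_cpt.comp_left rfl
  have hg₂ : ContDiff ℝ (⊤ : ℕ∞) (Complex.ofRealCLM ∘ g) := by fun_prop
  set φ : 𝓢(ℝ, ℂ) := hg₁.toSchwartzMap hg₂ with hφ
  have h2 := congrArg (fun T : 𝓢'(ℝ, ℂ) => T φ) h1
  rw [TemperedDistribution.fourier_apply, Lp.toTemperedDistribution_apply,
    Lp.toTemperedDistribution_apply] at h2
  have h3 : ∫ x, (𝓕 φ) x • (hf.toLp f) x = ∫ x, (𝓕 (φ : ℝ → ℂ)) x • f x := by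
    refine integral_congr_ae ?_
    filter_upwards [hf.coeFn_toLp] with x hx
    rw [hx, SchwartzMap.fourier_coe]
  have h4 : ∫ x, (𝓕 (φ : ℝ → ℂ)) x • f x = ∫ x, φ x • (𝓕 f) x := by
    simpa using! VectorFourier.integral_fourierIntegral_smul_eq_flip (L := innerₗ ℝ)
      Real.continuous_fourierChar continuous_inner φ.integrable hf1
  rw [h3, h4] at h2
  exact h2.symm

theorem fourier_exp_neg_half_abs_sub (t ξ : ℝ) :
    𝓕 (fun s : ℝ => ((Real.exp (-(1 / 2) * |s - t|) : ℝ) : ℂ)) ξ =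
      Complex.exp (-(2 * Real.pi * ξ * t : ℝ) * Complex.I) /
        (1 / 4 + (2 * Real.pi * ξ : ℝ) ^ 2 : ℂ) := by
  set c : ℝ := 2 * Real.pi * ξ with hc
  have hi : Integrable fun s : ℝ => Complex.exp (↑(-2 * Real.pi * s * ξ) * Complex.I) •
      ((Real.exp (-(1 / 2) * |s - t|) : ℝ) : ℂ) := by
    refine (integrable_exp_neg_mul_abs_sub (a := 1 / 2) (by norm_num) t).mono'
      (by fun_prop) (.of_forall fun s => ?_)
    rw [norm_smul, Complex.norm_exp_ofReal_mul_I, one_mul, Complex.norm_real, Real.norm_eq_abs,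
      Real.abs_exp]
  rw [Real.fourier_real_eq_integral_exp_smul,
    ← intervalIntegral.integral_Iic_add_Ioi (b := t) hi.integrableOn hi.integrableOn]
  have h1 : ∫ s in Set.Iic t, Complex.exp (↑(-2 * Real.pi * s * ξ) * Complex.I) •
      ((Real.exp (-(1 / 2) * |s - t|) : ℝ) : ℂ) =
      ∫ s in Set.Iic t, Complex.exp (-t / 2) * Complex.exp ((1 / 2 - c * Complex.I) * s) := by
    refine setIntegral_congr_fun measurableSet_Iic fun s hs => ?_
    rw [abs_of_nonpos (sub_nonpos.2 hs), smul_eq_mul, Complex.ofReal_exp, ← Complex.exp_add,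
      ← Complex.exp_add, hc]
    congr 1; push_cast; ring
  have h2 : ∫ s in Set.Ioi t, Complex.exp (↑(-2 * Real.pi * s * ξ) * Complex.I) •
      ((Real.exp (-(1 / 2) * |s - t|) : ℝ) : ℂ) =
      ∫ s in Set.Ioi t, Complex.exp (t / 2) * Complex.exp ((-(1 / 2) - c * Complex.I) * s) := by
    refine setIntegral_congr_fun measurableSet_Ioi fun s hs => ?_
    rw [abs_of_pos (sub_pos.2 hs), smul_eq_mul, Complex.ofReal_exp, ← Complex.exp_add,
      ← Complex.exp_add, hc]
    congr 1; push_cast; ring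
  rw [h1, h2, integral_const_mul, integral_const_mul,
    integral_exp_mul_complex_Iic (by simp), integral_exp_mul_complex_Ioi (by simp),
    mul_div_assoc', mul_div_assoc', mul_neg, ← Complex.exp_add, ← Complex.exp_add]
  have e1 : -(t : ℂ) / 2 + (1 / 2 - c * Complex.I) * t = -((c * t : ℝ) : ℂ) * Complex.I := by
    push_cast; ring
  have e2 : (t : ℂ) / 2 + (-(1 / 2) - c * Complex.I) * t = -((c * t : ℝ) : ℂ) * Complex.I := by
    push_cast; ring
  rw [e1, e2]
  have n1 : (1 / 2 - c * Complex.I : ℂ) ≠ 0 := fun h => by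
    have := congrArg Complex.re h
    simp at this
  have n2 : (-(1 / 2) - c * Complex.I : ℂ) ≠ 0 := fun h => by
    have := congrArg Complex.re h
    simp at this
  have n3 : (1 / 4 + (c : ℂ) ^ 2 : ℂ) =
      -((1 / 2 - c * Complex.I) * (-(1 / 2) - c * Complex.I)) := by
    linear_combination ((c : ℂ) ^ 2) * Complex.I_sq
  have n4 : (1 / 2 - c * Complex.I : ℂ) = (-(1 / 2) - c * Complex.I) + 1 := by ring
  rw [n3]
  rw [n4] at n1 ⊢
  generalize (-(1 / 2) - c * Complex.I : ℂ) = z at n1 n2 ⊢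
  field_simp
  ring

namespace EnergySpace

theorem fourier_kernel (t : ℝ) :
    (𝓕 (kernel t).toL2C : L2C) =ᵐ[volume] fun ξ =>
      Complex.exp (-(2 * Real.pi * ξ * t : ℝ) * Complex.I) /
        (1 / 4 + (2 * Real.pi * ξ : ℝ) ^ 2 : ℂ) := by
  have h2 : MemLp (fun s : ℝ => ((Real.exp (-(1 / 2) * |s - t|) : ℝ) : ℂ)) 2 volume :=
    (kernel t).memLp.ofReal
  have h1 : (kernel t).toL2C = h2.toLp _ := by
    refine Lp.ext ?_
    filter_upwards [coeFn_toL2C (kernel t), h2.coeFn_toLp] with s a b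
    rw [a, b, kernel_apply]
  rw [h1]
  refine (fourier_toLp_ae_eq h2 ?_).trans (.of_forall fun ξ => fourier_exp_neg_half_abs_sub t ξ)
  exact (integrable_exp_neg_mul_abs_sub (a := 1 / 2) (by norm_num) t).ofReal

theorem inner_ofRealL (f g : L2R) : (⟪ofRealL f, ofRealL g⟫_ℂ : ℂ) = ((⟪f, g⟫_ℝ : ℝ) : ℂ) := by
  rw [L2.inner_def, L2.inner_def, ← integral_complex_ofReal]
  refine integral_congr_ae ?_
  filter_upwards [coeFn_ofRealL f, coeFn_ofRealL g] with x h1 h2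
  rw [h1, h2]
  simp

/-- The inner product of `H^U` in Fourier variables. -/
theorem inner_eq_integral_fourier (g h : EnergySpace) :
    ((⟪g, h⟫_ℝ : ℝ) : ℂ) = ∫ ξ : ℝ, (1 / 4 + (2 * Real.pi * ξ : ℝ) ^ 2 : ℂ) *
      ((starRingEnd ℂ) ((𝓕 g.toL2C : L2C) ξ) * (𝓕 h.toL2C : L2C) ξ) := by
  rw [← diffOp.inner_map_map, ← inner_ofRealL, ← Lp.inner_fourier_eq, L2.inner_def]
  refine integral_congr_ae ?_
  filter_upwards [fourier_diffOp g, fourier_diffOp h] with ξ h1 h2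
  rw [h1, h2, RCLike.inner_apply]
  simp only [map_mul, map_add, Complex.conj_ofReal, Complex.conj_I, map_div₀, map_one, map_ofNat]
  push_cast
  linear_combination (-(2 * Real.pi * ξ) ^ 2 *
    ((starRingEnd ℂ) ((𝓕 g.toL2C : L2C) ξ) * (𝓕 h.toL2C : L2C) ξ)) * Complex.I_sq

/-- The inverse of the flow has the inverse symbol. -/
theorem fourier_flow_symm (u : ℝ) (h : EnergySpace) :
    (𝓕 ((flow u).symm h).toL2C : L2C) =ᵐ[volume]
      fun ξ => symbol (-u) (2 * Real.pi * ξ) * (𝓕 h.toL2C : L2C) ξ := by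
  have h1 := fourier_flow u ((flow u).symm h)
  rw [LinearIsometryEquiv.apply_symm_apply] at h1
  filter_upwards [h1] with ξ hξ
  rw [hξ, ← mul_assoc, ← symbol_add, neg_add_cancel, symbol_zero, one_mul]

/-- The vector `(𝒮ᵘ)⁻¹ kernel t`, which represents `ω ↦ Sᵘω(t)`. -/
noncomputable def flowKernel (u t : ℝ) : EnergySpace := (flow u).symm (kernel t)

theorem inner_flowKernel (u v s t : ℝ) :
    ((⟪flowKernel u s, flowKernel v t⟫_ℝ : ℝ) : ℂ) =
      2 / Real.pi * ∫ l : ℝ, Complex.exp (Complex.I *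
        ((t - s) * l + 2 * (u - v) * (Real.arctan (2 * l) : ℝ))) / (1 + 4 * (l : ℂ) ^ 2) := by
  set F : ℝ → ℂ := fun l => Complex.exp (Complex.I *
        ((t - s) * l + 2 * (u - v) * (Real.arctan (2 * l) : ℝ))) / (1 + 4 * (l : ℂ) ^ 2) with hF
  have h1 : ((⟪flowKernel u s, flowKernel v t⟫_ℝ : ℝ) : ℂ) =
      ∫ ξ : ℝ, 4 * F (2 * Real.pi * ξ) := by
    -- interchanging the arguments replaces the integrand by its conjugate, as in the stated formula
    rw [real_inner_comm, inner_eq_integral_fourier]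
    refine integral_congr_ae ?_
    filter_upwards [fourier_flow_symm u (kernel s), fourier_flow_symm v (kernel t),
      fourier_kernel s, fourier_kernel t] with ξ a b c d
    rw [flowKernel, flowKernel, a, b, c, d, hF]
    beta_reduce
    set l : ℝ := 2 * Real.pi * ξ
    have n1 : (1 / 4 + (l : ℂ) ^ 2 : ℂ) ≠ 0 := by
      have : (0 : ℝ) < 1 / 4 + l ^ 2 := by positivity
      have h2 := Complex.ofReal_ne_zero.2 this.ne'
      push_cast at h2
      exact h2
    have n2 : (1 + 4 * (l : ℂ) ^ 2 : ℂ) = 4 * (1 / 4 + (l : ℂ) ^ 2) := by ring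
    have e1 : (starRingEnd ℂ) (Complex.exp (-((l * t : ℝ) : ℂ) * Complex.I)) =
        Complex.exp ((l * t : ℝ) * Complex.I) := by
      rw [← Complex.exp_conj, map_mul, map_neg, Complex.conj_ofReal, Complex.conj_I, neg_mul_neg]
    have e2 : (starRingEnd ℂ) (symbol (-v) l) = symbol v l := by
      rw [symbol, symbol, ← Complex.exp_conj, map_mul, Complex.conj_ofReal, Complex.conj_I]
      congr 1; push_cast; ring
    have e3 : Complex.exp (Complex.I * ((t - s) * l + 2 * (u - v) * (Real.arctan (2 * l) : ℝ))) =
        symbol v l * symbol (-u) l * (Complex.exp ((l * t : ℝ) * Complex.I) *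
          Complex.exp (-((l * s : ℝ) : ℂ) * Complex.I)) := by
      rw [symbol, symbol, ← Complex.exp_add, ← Complex.exp_add, ← Complex.exp_add]
      congr 1; push_cast; ring
    have e4 : (starRingEnd ℂ) (1 / 4 + (l : ℂ) ^ 2) = 1 / 4 + (l : ℂ) ^ 2 := by
      have : (1 / 4 + (l : ℂ) ^ 2 : ℂ) = ((1 / 4 + l ^ 2 : ℝ) : ℂ) := by push_cast; rfl
      rw [this, Complex.conj_ofReal]
    rw [map_mul, map_div₀, e1, e2, e3, e4, n2]
    field_simp
  rw [h1, integral_const_mul, Measure.integral_comp_mul_left F (2 * Real.pi), Complex.real_smul,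
    abs_of_pos (by positivity)]
  push_cast
  have : (Real.pi : ℂ) ≠ 0 := by exact_mod_cast Real.pi_ne_zero
  field_simp
  ring

theorem inner_flowKernel_self (u s t : ℝ) :
    ⟪flowKernel u s, flowKernel u t⟫_ℝ = Real.exp (-|t - s| / 2) := by
  rw [flowKernel, flowKernel, LinearIsometryEquiv.inner_map_map, inner_kernel_kernel]

/-! ### The modulus of continuity of the covariance -/

theorem integrable_inv_one_add_four_mul_sq : Integrable fun l : ℝ => (1 + 4 * l ^ 2)⁻¹ := by
  refine (integrable_inv_one_add_sq.comp_mul_left' (R := 2) two_ne_zero).congr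
    (.of_forall fun l => ?_)
  beta_reduce
  congr 1; ring

theorem integral_inv_one_add_four_mul_sq : ∫ l : ℝ, (1 + 4 * l ^ 2)⁻¹ = Real.pi / 2 := by
  have h1 := Measure.integral_comp_mul_left (fun l : ℝ => (1 + l ^ 2)⁻¹) 2
  rw [integral_univ_inv_one_add_sq, abs_of_pos (by norm_num), smul_eq_mul] at h1
  calc _ = ∫ l : ℝ, (1 + (2 * l) ^ 2)⁻¹ := by congr 1; ext l; congr 1; ring
    _ = _ := by rw [h1]; ring

theorem norm_one_add_four_mul_sq (l : ℝ) : ‖(1 + 4 * (l : ℂ) ^ 2 : ℂ)‖ = 1 + 4 * l ^ 2 := by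
  have : (1 + 4 * (l : ℂ) ^ 2 : ℂ) = ((1 + 4 * l ^ 2 : ℝ) : ℂ) := by push_cast; rfl
  rw [this, Complex.norm_real, Real.norm_eq_abs, abs_of_pos (by positivity)]

theorem integrable_exp_div (θ : ℝ → ℝ) (hθ : Continuous θ) :
    Integrable fun l : ℝ => Complex.exp (Complex.I * θ l) / (1 + 4 * (l : ℂ) ^ 2) := by
  refine integrable_inv_one_add_four_mul_sq.mono' ?_ (.of_forall fun l => ?_)
  · refine (Continuous.div (by fun_prop) (by fun_prop) fun l => ?_).aestronglyMeasurable
    rw [← norm_ne_zero_iff, norm_one_add_four_mul_sq]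
    positivity
  · rw [norm_div, mul_comm, Complex.norm_exp_ofReal_mul_I, norm_one_add_four_mul_sq, one_div]

/-- The dependence of the covariance on `u - v` is Lipschitz, as `|Arctg| ≤ π / 2`. -/
theorem abs_inner_flowKernel_sub_le (u v s t : ℝ) :
    |⟪flowKernel u s, flowKernel v t⟫_ℝ - Real.exp (-|t - s| / 2)| ≤ Real.pi * |u - v| := by
  have hpi := Real.pi_pos
  have key (w : ℝ) : ((⟪flowKernel w s, flowKernel v t⟫_ℝ : ℝ) : ℂ) = 2 / Real.pi *
      ∫ l : ℝ, Complex.exp (Complex.I * ((t - s) * l + 2 * (w - v) * Real.arctan (2 * l) : ℝ)) /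
        (1 + 4 * (l : ℂ) ^ 2) := by
    rw [inner_flowKernel]
    push_cast
    rfl
  have hi (w : ℝ) := integrable_exp_div
    (fun l => (t - s) * l + 2 * (w - v) * Real.arctan (2 * l)) (by fun_prop)
  rw [← inner_flowKernel_self v s t, ← Real.norm_eq_abs, ← Complex.norm_real, Complex.ofReal_sub,
    key u, key v, ← mul_sub, ← integral_sub (hi u) (hi v), norm_mul]
  have h1 : ‖(2 / Real.pi : ℂ)‖ = 2 / Real.pi := by
    rw [norm_div, Complex.norm_real, Real.norm_eq_abs, abs_of_pos hpi, Complex.norm_ofNat]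
  have h2 : ‖∫ l : ℝ, (Complex.exp (Complex.I *
        ((t - s) * l + 2 * (u - v) * Real.arctan (2 * l) : ℝ)) / (1 + 4 * (l : ℂ) ^ 2) -
      Complex.exp (Complex.I *
        ((t - s) * l + 2 * (v - v) * Real.arctan (2 * l) : ℝ)) / (1 + 4 * (l : ℂ) ^ 2))‖ ≤
      ∫ l : ℝ, Real.pi * |u - v| * (1 + 4 * l ^ 2)⁻¹ := by
    refine norm_integral_le_of_norm_le (integrable_inv_one_add_four_mul_sq.const_mul _)
      (.of_forall fun l => ?_)
    rw [← sub_div, norm_div, norm_one_add_four_mul_sq, div_eq_mul_inv]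
    refine mul_le_mul_of_nonneg_right ?_ (by positivity)
    refine (norm_exp_I_mul_ofReal_sub_exp_le _ _).trans ?_
    have h3 : |Real.arctan (2 * l)| ≤ Real.pi / 2 :=
      abs_le.2 ⟨(Real.neg_pi_div_two_lt_arctan _).le, (Real.arctan_lt_pi_div_two _).le⟩
    have h4 : (t - s) * l + 2 * (u - v) * Real.arctan (2 * l) -
        ((t - s) * l + 2 * (v - v) * Real.arctan (2 * l)) = 2 * (u - v) * Real.arctan (2 * l) := by
      ring
    rw [h4, abs_mul, abs_mul, abs_of_pos (two_pos : (0 : ℝ) < 2)]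
    nlinarith [abs_nonneg (u - v)]
  rw [integral_const_mul, integral_inv_one_add_four_mul_sq] at h2
  rw [h1]
  calc _ ≤ 2 / Real.pi * (Real.pi * |u - v| * (Real.pi / 2)) :=
        mul_le_mul_of_nonneg_left h2 (by positivity)
    _ = _ := by field_simp

theorem abs_one_sub_inner_flowKernel_le (u v s t : ℝ) :
    |1 - ⟪flowKernel u s, flowKernel v t⟫_ℝ| ≤ Real.pi * |u - v| + |t - s| / 2 := by
  have h1 := abs_le.1 (abs_inner_flowKernel_sub_le u v s t)
  have h2 := Real.add_one_le_exp (-|t - s| / 2)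
  have h3 : Real.exp (-|t - s| / 2) ≤ 1 :=
    Real.exp_le_one_iff.2 (by linarith [abs_nonneg (t - s)])
  rw [abs_le]
  constructor <;> linarith [abs_nonneg (t - s), h1.1, h1.2]

theorem norm_flowKernel (u t : ℝ) : ‖flowKernel u t‖ = 1 := by
  have h1 := inner_flowKernel_self u t t
  rw [real_inner_self_eq_norm_sq, sub_self, abs_zero, neg_zero, zero_div, Real.exp_zero] at h1
  exact (pow_eq_one_iff_of_nonneg (norm_nonneg _) two_ne_zero).1 h1

theorem norm_flowKernel_sub_sq_le (p q : ℝ × ℝ) :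
    ‖flowKernel p.1 p.2 - flowKernel q.1 q.2‖ ^ 2 ≤ (2 * Real.pi + 1) * dist p q := by
  have h1 := (abs_le.1 (abs_one_sub_inner_flowKernel_le p.1 q.1 p.2 q.2)).2
  have h2 : |p.1 - q.1| ≤ dist p q := le_max_left _ _
  have h3 : |q.2 - p.2| ≤ dist p q := by rw [abs_sub_comm]; exact le_max_right _ _
  rw [norm_sub_sq_real, norm_flowKernel, norm_flowKernel]
  nlinarith [Real.pi_pos]

end EnergySpace
end WienerFlow

namespace WienerFlow

/-! ### A Kolmogorov continuity criterion in the plane -/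

/-- The point of the dyadic grid of mesh `2⁻ⁿ` with integer coordinates `a`. -/
noncomputable def dyadic (n : ℕ) (a : ℤ × ℤ) : ℝ × ℝ := (a.1 / 2 ^ n, a.2 / 2 ^ n)

/-- The integer coordinates of the lower left corner of the cell of mesh `2⁻ⁿ` that contains `p`. -/
noncomputable def dyadicFloor (n : ℕ) (p : ℝ × ℝ) : ℤ × ℤ := (⌊2 ^ n * p.1⌋, ⌊2 ^ n * p.2⌋)

theorem dist_dyadic_dyadicFloor_le (n : ℕ) (p : ℝ × ℝ) :
    dist (dyadic n (dyadicFloor n p)) p ≤ 1 / 2 ^ n := by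
  have key (x : ℝ) : |(⌊2 ^ n * x⌋ : ℝ) / 2 ^ n - x| ≤ 1 / 2 ^ n := by
    have h2 : (0 : ℝ) < 2 ^ n := by positivity
    have h1 : (⌊2 ^ n * x⌋ : ℝ) / 2 ^ n - x = (⌊2 ^ n * x⌋ - 2 ^ n * x) / 2 ^ n := by field_simp
    rw [h1, abs_div, abs_of_pos h2]
    refine div_le_div_of_nonneg_right (abs_le.2 ⟨?_, ?_⟩) h2.le
    · linarith [Int.lt_floor_add_one (2 ^ n * x)]
    · linarith [Int.floor_le (2 ^ n * x)]
  exact max_le (key p.1) (key p.2)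

theorem dyadic_succ_two_mul (n : ℕ) (a : ℤ × ℤ) :
    dyadic (n + 1) (2 * a.1, 2 * a.2) = dyadic n a := by
  have h2 : (2 : ℝ) ^ n ≠ 0 := by positivity
  ext
  · simp only [dyadic]; push_cast; rw [pow_succ]; field_simp
  · simp only [dyadic]; push_cast; rw [pow_succ]; field_simp

theorem dist_dyadic_le {n : ℕ} {a b : ℤ × ℤ} (h1 : |b.1 - a.1| ≤ 1) (h2 : |b.2 - a.2| ≤ 1) :
    dist (dyadic n b) (dyadic n a) ≤ 1 / 2 ^ n := by
  have key (i j : ℤ) (h : |i - j| ≤ 1) : |(i : ℝ) / 2 ^ n - j / 2 ^ n| ≤ 1 / 2 ^ n := by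
    have h2 : (0 : ℝ) < 2 ^ n := by positivity
    rw [← sub_div, abs_div, abs_of_pos h2]
    refine div_le_div_of_nonneg_right ?_ h2.le
    exact_mod_cast h
  exact max_le (key _ _ h1) (key _ _ h2)

theorem abs_floor_sub_floor_le_one {z w : ℝ} (h : |z - w| ≤ 1) : |⌊z⌋ - ⌊w⌋| ≤ 1 := by
  have h1 := abs_le.1 h
  have a1 := Int.floor_le z
  have a2 := Int.lt_floor_add_one z
  have b1 := Int.floor_le w
  have b2 := Int.lt_floor_add_one w
  have c1 : (⌊z⌋ : ℝ) < ((⌊w⌋ + 2 : ℤ) : ℝ) := by push_cast; linarith [h1.2]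
  have c2 : (⌊w⌋ : ℝ) < ((⌊z⌋ + 2 : ℤ) : ℝ) := by push_cast; linarith [h1.1]
  have d1 := Int.cast_lt.1 c1
  have d2 := Int.cast_lt.1 c2
  rw [abs_le]
  omega

theorem abs_floor_two_mul_sub_le_one (z : ℝ) : |⌊2 * z⌋ - 2 * ⌊z⌋| ≤ 1 := by
  have a1 := Int.floor_le z
  have a2 := Int.lt_floor_add_one z
  have b1 := Int.floor_le (2 * z)
  have b2 := Int.lt_floor_add_one (2 * z)
  have c1 : (⌊2 * z⌋ : ℝ) < ((2 * ⌊z⌋ + 2 : ℤ) : ℝ) := by push_cast; linarith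
  have c2 : ((2 * ⌊z⌋ : ℤ) : ℝ) < ((⌊2 * z⌋ + 1 : ℤ) : ℝ) := by push_cast; linarith
  have d1 := Int.cast_lt.1 c1
  have d2 := Int.cast_lt.1 c2
  rw [abs_le]
  omega

theorem abs_floor_le {z : ℝ} {M : ℤ} (h : |z| ≤ M) : |⌊z⌋| ≤ M := by
  have h1 := abs_le.1 h
  rw [abs_le]
  constructor
  · rw [Int.le_floor]; push_cast; exact h1.1
  · exact_mod_cast (Int.floor_le z).trans h1.2

/-- The increments of `x` between neighbours in the dyadic grids are at most `K rⁿ` on the box of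
half-width `N`. -/
def DyadicBound (x : ℝ × ℝ → ℝ) (r : ℝ) (N : ℕ) (K : ℝ) : Prop :=
  ∀ (n : ℕ) (a b : ℤ × ℤ), |a.1| ≤ N * 2 ^ n → |a.2| ≤ N * 2 ^ n → |b.1 - a.1| ≤ 1 →
    |b.2 - a.2| ≤ 1 → |x (dyadic n b) - x (dyadic n a)| ≤ K * r ^ n

theorem abs_dyadicFloor_le {N : ℕ} {p : ℝ × ℝ} (hp : ‖p‖ ≤ N) (n : ℕ) :
    |(dyadicFloor n p).1| ≤ N * 2 ^ n ∧ |(dyadicFloor n p).2| ≤ N * 2 ^ n := by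
  have key (x : ℝ) (hx : |x| ≤ N) : |⌊2 ^ n * x⌋| ≤ (N * 2 ^ n : ℤ) := by
    refine abs_floor_le ?_
    rw [abs_mul, abs_of_pos (by positivity)]
    push_cast
    rw [mul_comm]
    exact mul_le_mul_of_nonneg_right hx (by positivity)
  exact ⟨key _ ((le_max_left _ _).trans hp), key _ ((le_max_right _ _).trans hp)⟩

theorem DyadicBound.dist_succ_le {x : ℝ × ℝ → ℝ} {r : ℝ} {N : ℕ} {K : ℝ}
    (hx : DyadicBound x r N K) {p : ℝ × ℝ} (hp : ‖p‖ ≤ N) (n : ℕ) :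
    dist (x (dyadic n (dyadicFloor n p))) (x (dyadic (n + 1) (dyadicFloor (n + 1) p))) ≤
      K * r * r ^ n := by
  rw [dist_comm, Real.dist_eq, ← dyadic_succ_two_mul n, mul_assoc, ← pow_succ']
  obtain ⟨h1, h2⟩ := abs_dyadicFloor_le hp n
  have e (y : ℝ) : (2 : ℝ) ^ (n + 1) * y = 2 * (2 ^ n * y) := by ring
  have two (i : ℤ) (hi : |i| ≤ N * 2 ^ n) : |2 * i| ≤ N * 2 ^ (n + 1) := by
    rw [abs_mul, abs_two, pow_succ]; linarith
  refine hx (n + 1) _ _ (two _ h1) (two _ h2) ?_ ?_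
  · simp only [dyadicFloor, e]; exact abs_floor_two_mul_sub_le_one _
  · simp only [dyadicFloor, e]; exact abs_floor_two_mul_sub_le_one _

/-- If the increments over neighbours in the dyadic grids decay geometrically, the restriction of
`x` to the dyadic points extends to a continuous function. -/
theorem exists_continuous_tendsto_dyadic {x : ℝ × ℝ → ℝ} {r : ℝ} (hr0 : 0 < r) (hr1 : r < 1)
    (hx : ∀ N : ℕ, ∃ K, DyadicBound x r N K) :
    ∃ y : ℝ × ℝ → ℝ, Continuous y ∧
      ∀ p, Tendsto (fun n => x (dyadic n (dyadicFloor n p))) atTop (𝓝 (y p)) := by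
  have hconv (p : ℝ × ℝ) : ∃ l, Tendsto (fun n => x (dyadic n (dyadicFloor n p))) atTop (𝓝 l) := by
    obtain ⟨N, hN⟩ := exists_nat_ge ‖p‖
    obtain ⟨K, hK⟩ := hx N
    exact cauchySeq_tendsto_of_complete
      (cauchySeq_of_le_geometric r (K * r) hr1 fun n => hK.dist_succ_le hN n)
  choose y hy using hconv
  refine ⟨y, continuous_iff_continuousAt.2 fun p => ?_, hy⟩
  obtain ⟨N, hN⟩ := exists_nat_ge (‖p‖ + 1)
  obtain ⟨K, hK⟩ := hx N
  have hp : ‖p‖ ≤ N := by linarith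
  have hlim : Tendsto (fun n : ℕ => 2 * (K * r * r ^ n / (1 - r)) + K * r ^ n) atTop (𝓝 0) := by
    have h1 := tendsto_pow_atTop_nhds_zero_of_lt_one hr0.le hr1
    have h2 := (((h1.const_mul (K * r)).div_const (1 - r)).const_mul 2).add (h1.const_mul K)
    simpa using h2
  rw [Metric.continuousAt_iff]
  intro ε hε
  obtain ⟨n, hn⟩ := (hlim.eventually (gt_mem_nhds hε)).exists
  refine ⟨1 / 2 ^ n, by positivity, fun q hq => ?_⟩
  have h2n : (0 : ℝ) < 2 ^ n := by positivity
  have hq1 : dist q p ≤ 1 := by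
    refine hq.le.trans ?_
    rw [div_le_one h2n]
    exact one_le_pow₀ one_le_two
  have hqN : ‖q‖ ≤ N := by
    have h3 := norm_le_norm_add_norm_sub p q
    rw [← dist_eq_norm, dist_comm] at h3
    linarith
  have a1 := dist_le_of_le_geometric_of_tendsto r (K * r) hr1
    (fun n => hK.dist_succ_le hp n) (hy p) n
  have a2 := dist_le_of_le_geometric_of_tendsto r (K * r) hr1
    (fun n => hK.dist_succ_le hqN n) (hy q) n
  have hmul (z w : ℝ) (h : |z - w| ≤ dist q p) : |2 ^ n * z - 2 ^ n * w| ≤ 1 := by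
    rw [← mul_sub, abs_mul, abs_of_pos h2n]
    have h4 : 2 ^ n * |z - w| ≤ 2 ^ n * (1 / 2 ^ n) :=
      mul_le_mul_of_nonneg_left (h.trans hq.le) h2n.le
    rwa [mul_one_div_cancel h2n.ne'] at h4
  have a3 : dist (x (dyadic n (dyadicFloor n q))) (x (dyadic n (dyadicFloor n p))) ≤ K * r ^ n := by
    obtain ⟨b1, b2⟩ := abs_dyadicFloor_le hp n
    exact hK n _ _ b1 b2 (abs_floor_sub_floor_le_one (hmul _ _ (le_max_left _ _)))
      (abs_floor_sub_floor_le_one (hmul _ _ (le_max_right _ _)))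
  rw [dist_comm] at a2
  calc dist (y q) (y p) ≤ _ := dist_triangle4 _ _ _ _
    _ ≤ K * r * r ^ n / (1 - r) + K * r ^ n + K * r * r ^ n / (1 - r) := by gcongr
    _ < ε := by linarith

/-- The integer points in the box of half-width `N * 2 ^ n`. -/
noncomputable def dyadicBox (N n : ℕ) : Finset (ℤ × ℤ) :=
  Finset.Icc (-(N * 2 ^ n : ℤ)) (N * 2 ^ n) ×ˢ Finset.Icc (-(N * 2 ^ n : ℤ)) (N * 2 ^ n)

theorem card_dyadicBox_le (N n : ℕ) : (dyadicBox N n).card ≤ (2 * N + 1) ^ 2 * 4 ^ n := by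
  have h1 : (dyadicBox N n).card = (2 * N * 2 ^ n + 1) ^ 2 := by
    rw [dyadicBox, Finset.card_product, Int.card_Icc, sq]
    have : ((N * 2 ^ n : ℤ) + 1 - -(N * 2 ^ n : ℤ)) = ((2 * N * 2 ^ n + 1 : ℕ) : ℤ) := by
      push_cast; ring
    rw [this, Int.toNat_natCast]
  have h2 : (4 : ℕ) ^ n = (2 ^ n) ^ 2 := by rw [← pow_mul, mul_comm, pow_mul]; norm_num
  rw [h1, h2, ← mul_pow]
  refine Nat.pow_le_pow_left ?_ 2
  have : 1 ≤ 2 ^ n := Nat.one_le_two_pow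
  nlinarith

section Kolmogorov

variable {Ω : Type*}

open scoped ENNReal

/-- The weighted sum, over all levels `n`, of the sixth powers of the increments between neighbours
of the grid of mesh `2⁻ⁿ` in the box of half-width `N`. -/
noncomputable def incrementSum (X : ℝ × ℝ → Ω → ℝ) (N : ℕ) (ω : Ω) : ℝ≥0∞ :=
  ∑' n : ℕ, ∑ a ∈ dyadicBox N n, ∑ e ∈ Finset.Icc (-1 : ℤ) 1 ×ˢ Finset.Icc (-1 : ℤ) 1,
    (ENNReal.ofReal ((11 / 10) ^ n) * ‖X (dyadic n (a + e)) ω - X (dyadic n a) ω‖ₑ) ^ 6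

theorem exists_dyadicBound_of_incrementSum_lt_top {X : ℝ × ℝ → Ω → ℝ} {N : ℕ} {ω : Ω}
    (h : incrementSum X N ω < ∞) : ∃ K, DyadicBound (fun p => X p ω) (10 / 11) N K := by
  refine ⟨(incrementSum X N ω + 1).toReal, fun n a b ha1 ha2 hb1 hb2 => ?_⟩
  have hmem : a ∈ dyadicBox N n := by
    simp only [dyadicBox, Finset.mem_product, Finset.mem_Icc]
    exact ⟨abs_le.1 ha1, abs_le.1 ha2⟩
  have hbmem : b - a ∈ Finset.Icc (-1 : ℤ) 1 ×ˢ Finset.Icc (-1 : ℤ) 1 := by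
    simp only [Finset.mem_product, Finset.mem_Icc]
    exact ⟨abs_le.1 hb1, abs_le.1 hb2⟩
  set T : ℝ≥0∞ := ENNReal.ofReal ((11 / 10) ^ n) * ‖X (dyadic n b) ω - X (dyadic n a) ω‖ₑ with hT
  have h1 : T ^ 6 ≤ incrementSum X N ω := by
    unfold incrementSum
    refine le_trans ?_ (ENNReal.le_tsum n)
    refine le_trans ?_ (Finset.single_le_sum (fun _ _ => zero_le) hmem)
    refine le_trans ?_ (Finset.single_le_sum (fun _ _ => zero_le) hbmem)
    rw [add_sub_cancel]
  have h2 : T ≤ incrementSum X N ω + 1 := by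
    rcases le_total T 1 with h3 | h3
    · exact h3.trans le_add_self
    · exact ((le_self_pow₀ h3 (by norm_num)).trans h1).trans le_self_add
  have h4 := ENNReal.toReal_mono (by finiteness) h2
  rw [hT, ENNReal.toReal_mul, ENNReal.toReal_ofReal (by positivity), toReal_enorm,
    Real.norm_eq_abs] at h4
  have h5 : (10 / 11 : ℝ) ^ n * (11 / 10) ^ n = 1 := by rw [← mul_pow]; norm_num
  calc _ = (10 / 11 : ℝ) ^ n * ((11 / 10) ^ n * |X (dyadic n b) ω - X (dyadic n a) ω|) := by
        rw [← mul_assoc, h5, one_mul]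
    _ ≤ (10 / 11 : ℝ) ^ n * (incrementSum X N ω + 1).toReal := by gcongr
    _ = _ := mul_comm _ _

variable [MeasurableSpace Ω] {P : Measure Ω}

theorem measurable_incrementSum {X : ℝ × ℝ → Ω → ℝ} (hX : ∀ p, Measurable (X p)) (N : ℕ) :
    Measurable (incrementSum X N) := by
  unfold incrementSum
  refine Measurable.tsum fun n => Finset.measurable_sum _ fun a _ =>
    Finset.measurable_sum _ fun e _ => ?_
  exact (((hX _).sub (hX _)).enorm.const_mul _).pow_const 6

/-- There are of order `4ⁿ` pairs of neighbours at level `n`, and each contributes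
at most `C (11 / 10) ^ (6 n) 8⁻ⁿ`; the resulting ratio `(11 / 10) ^ 6 / 2` is less than `1`. -/
theorem lintegral_incrementSum_lt_top {X : ℝ × ℝ → Ω → ℝ} (hX : ∀ p, Measurable (X p)) {C : ℝ≥0∞}
    (hC : C ≠ ∞) (hXC : ∀ p q, ∫⁻ ω, ‖X p ω - X q ω‖ₑ ^ 6 ∂P ≤ C * ENNReal.ofReal (dist p q) ^ 3)
    (N : ℕ) : ∫⁻ ω, incrementSum X N ω ∂P < ∞ := by
  set q : ℝ := (11 / 10) ^ 6 / 2 with hq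
  have hm (n : ℕ) (a e : ℤ × ℤ) : Measurable fun ω =>
      (ENNReal.ofReal ((11 / 10) ^ n) * ‖X (dyadic n (a + e)) ω - X (dyadic n a) ω‖ₑ) ^ 6 :=
    (((hX _).sub (hX _)).enorm.const_mul _).pow_const 6
  have hterm (n : ℕ) (a e : ℤ × ℤ) (he : e ∈ Finset.Icc (-1 : ℤ) 1 ×ˢ Finset.Icc (-1 : ℤ) 1) :
      ∫⁻ ω, (ENNReal.ofReal ((11 / 10) ^ n) *
        ‖X (dyadic n (a + e)) ω - X (dyadic n a) ω‖ₑ) ^ 6 ∂P ≤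
      ENNReal.ofReal ((11 / 10) ^ n) ^ 6 * (C * ENNReal.ofReal (1 / 2 ^ n) ^ 3) := by
    simp_rw [mul_pow]
    rw [lintegral_const_mul _ (by fun_prop)]
    gcongr
    refine (hXC _ _).trans ?_
    gcongr
    simp only [Finset.mem_product, Finset.mem_Icc] at he
    refine dist_dyadic_le ?_ ?_
    · rw [Prod.fst_add, add_sub_cancel_left, abs_le]; exact he.1
    · rw [Prod.snd_add, add_sub_cancel_left, abs_le]; exact he.2
  have hlevel (n : ℕ) : ∫⁻ ω, (∑ a ∈ dyadicBox N n,
      ∑ e ∈ Finset.Icc (-1 : ℤ) 1 ×ˢ Finset.Icc (-1 : ℤ) 1,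
      (ENNReal.ofReal ((11 / 10) ^ n) * ‖X (dyadic n (a + e)) ω - X (dyadic n a) ω‖ₑ) ^ 6) ∂P ≤
      ((2 * N + 1) ^ 2 * 9 * C) * ENNReal.ofReal q ^ n := by
    rw [lintegral_finsetSum _ fun a _ => Finset.measurable_sum _ fun e _ => hm n a e]
    have h1 : ∀ a ∈ dyadicBox N n, ∫⁻ ω, (∑ e ∈ Finset.Icc (-1 : ℤ) 1 ×ˢ Finset.Icc (-1 : ℤ) 1,
        (ENNReal.ofReal ((11 / 10) ^ n) * ‖X (dyadic n (a + e)) ω - X (dyadic n a) ω‖ₑ) ^ 6) ∂P ≤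
        9 * (ENNReal.ofReal ((11 / 10) ^ n) ^ 6 * (C * ENNReal.ofReal (1 / 2 ^ n) ^ 3)) := by
      intro a _
      rw [lintegral_finsetSum _ fun e _ => hm n a e]
      refine (Finset.sum_le_card_nsmul _ _ _ fun e he => hterm n a e he).trans (le_of_eq ?_)
      have hcard : (Finset.Icc (-1 : ℤ) 1 ×ˢ Finset.Icc (-1 : ℤ) 1).card = 9 := by
        rw [Finset.card_product, Int.card_Icc]
        rfl
      rw [hcard, nsmul_eq_mul, Nat.cast_ofNat]
    refine (Finset.sum_le_card_nsmul _ _ _ h1).trans ?_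
    rw [nsmul_eq_mul]
    have h2 : ((dyadicBox N n).card : ℝ≥0∞) ≤ (2 * N + 1) ^ 2 * 4 ^ n := by
      exact_mod_cast card_dyadicBox_le N n
    have h3 : (4 : ℝ≥0∞) ^ n * (ENNReal.ofReal ((11 / 10) ^ n) ^ 6 *
        ENNReal.ofReal (1 / 2 ^ n) ^ 3) = ENNReal.ofReal q ^ n := by
      have h4 : (4 : ℝ≥0∞) ^ n = ENNReal.ofReal (4 ^ n) := by
        rw [ENNReal.ofReal_pow (by norm_num)]; norm_num
      rw [h4, ← ENNReal.ofReal_pow (by positivity), ← ENNReal.ofReal_pow (by positivity),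
        ← ENNReal.ofReal_mul (by positivity), ← ENNReal.ofReal_mul (by positivity),
        ← ENNReal.ofReal_pow (by positivity)]
      congr 1
      rw [hq, ← one_div_pow, pow_right_comm _ n 6, pow_right_comm _ n 3, ← mul_pow, ← mul_pow]
      norm_num
    calc _ ≤ (2 * N + 1) ^ 2 * 4 ^ n * (9 * (ENNReal.ofReal ((11 / 10) ^ n) ^ 6 *
          (C * ENNReal.ofReal (1 / 2 ^ n) ^ 3))) := by gcongr
      _ = ((2 * N + 1) ^ 2 * 9 * C) * (4 ^ n * (ENNReal.ofReal ((11 / 10) ^ n) ^ 6 *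
          ENNReal.ofReal (1 / 2 ^ n) ^ 3)) := by ring
      _ = _ := by rw [h3]
  unfold incrementSum
  rw [lintegral_tsum fun n => (Finset.measurable_sum _ fun a _ =>
    Finset.measurable_sum _ fun e _ => hm n a e).aemeasurable]
  refine (ENNReal.tsum_le_tsum hlevel).trans_lt ?_
  rw [ENNReal.tsum_mul_left, ENNReal.tsum_geometric]
  refine ENNReal.mul_lt_top ?_ ?_
  · refine ENNReal.mul_lt_top (ENNReal.mul_lt_top ?_ (by simp)) hC.lt_top
    exact ENNReal.pow_lt_top (by finiteness)
  · rw [ENNReal.inv_lt_top, tsub_pos_iff_lt, ENNReal.ofReal_lt_one]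
    norm_num [hq]

/-- Kolmogorov's criterion in dimension two, with sixth moments of order `3 > 2`. -/
theorem exists_continuous_modification {X : ℝ × ℝ → Ω → ℝ} (hX : ∀ p, AEMeasurable (X p) P)
    {C : ℝ≥0∞} (hC : C ≠ ∞)
    (hXC : ∀ p q, ∫⁻ ω, ‖X p ω - X q ω‖ₑ ^ 6 ∂P ≤ C * ENNReal.ofReal (dist p q) ^ 3) :
    ∃ Y : ℝ × ℝ → Ω → ℝ, (∀ p, Measurable (Y p)) ∧ (∀ p, Y p =ᵐ[P] X p) ∧
      ∀ ω, Continuous fun p => Y p ω := by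
  classical
  wlog hXm : ∀ p, Measurable (X p) generalizing X
  · obtain ⟨Y, h1, h2, h3⟩ := this (X := fun p => (hX p).mk (X p))
      (fun p => (hX p).measurable_mk.aemeasurable) (fun p q => by
        refine (lintegral_congr_ae ?_).trans_le (hXC p q)
        filter_upwards [(hX p).ae_eq_mk, (hX q).ae_eq_mk] with ω a b
        rw [a, b]) (fun p => (hX p).measurable_mk)
    exact ⟨Y, h1, fun p => (h2 p).trans (hX p).ae_eq_mk.symm, h3⟩
  set G : Set Ω := {ω | ∀ N, incrementSum X N ω < ∞} with hG
  have hGm : MeasurableSet G := by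
    rw [hG, Set.ofPred_forall]
    exact MeasurableSet.iInter fun N =>
      measurableSet_lt (measurable_incrementSum hXm N) measurable_const
  have hGae : ∀ᵐ ω ∂P, ω ∈ G := ae_all_iff.2 fun N =>
    ae_lt_top (measurable_incrementSum hXm N) (lintegral_incrementSum_lt_top hXm hC hXC N).ne
  have hy (ω : Ω) : ∃ y : ℝ × ℝ → ℝ, Continuous y ∧ ∀ p,
      Tendsto (fun n => G.indicator (X (dyadic n (dyadicFloor n p))) ω) atTop (𝓝 (y p)) := by
    by_cases hω : ω ∈ G
    · simp only [Set.indicator_of_mem hω]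
      exact exists_continuous_tendsto_dyadic (x := fun p => X p ω) (by norm_num) (by norm_num)
        fun N => exists_dyadicBound_of_incrementSum_lt_top (hω N)
    · simp only [Set.indicator_of_notMem hω]
      exact ⟨fun _ => 0, continuous_const, fun _ => tendsto_const_nhds⟩
  choose y hyc hyt using hy
  refine ⟨fun p ω => y ω p, fun p => ?_, fun p => ?_, hyc⟩
  · exact measurable_of_tendsto_metrizable (fun n => (hXm _).indicator hGm)
      (tendsto_pi_nhds.2 fun ω => hyt ω p)
  · -- by Fatou's lemma the limit along the grid agrees almost surely with `X p`
    have h1 : ∫⁻ ω, liminf (fun n => ‖X (dyadic n (dyadicFloor n p)) ω - X p ω‖ₑ ^ 6) atTop ∂P ≤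
        0 := by
      refine (lintegral_liminf_le fun n => ((hXm _).sub (hXm _)).enorm.pow_const 6).trans ?_
      have h2 : Tendsto (fun n : ℕ => C * ENNReal.ofReal (1 / 2 ^ n) ^ 3) atTop (𝓝 0) := by
        have h3 : Tendsto (fun n : ℕ => (1 / 2 ^ n : ℝ)) atTop (𝓝 0) := by
          simpa using tendsto_pow_atTop_nhds_zero_of_lt_one (r := (1 / 2 : ℝ))
            (by norm_num) (by norm_num)
        have h4 := ENNReal.Tendsto.const_mul (a := C)
          (ENNReal.Tendsto.pow (n := 3) (ENNReal.tendsto_ofReal h3)) (Or.inr hC)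
        simpa using h4
      rw [← h2.liminf_eq]
      refine liminf_le_liminf (.of_forall fun n => (hXC _ _).trans ?_)
      gcongr
      exact dist_dyadic_dyadicFloor_le n p
    have h2 := (lintegral_eq_zero_iff (.liminf fun n =>
      ((hXm _).sub (hXm _)).enorm.pow_const 6)).1 (le_antisymm h1 zero_le)
    filter_upwards [h2, hGae] with ω a b
    have h3 : Tendsto (fun n => ‖X (dyadic n (dyadicFloor n p)) ω - X p ω‖ₑ ^ 6) atTop
        (𝓝 (‖y ω p - X p ω‖ₑ ^ 6)) := by
      have h4 := hyt ω p
      simp only [Set.indicator_of_mem b] at h4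
      exact ENNReal.Tendsto.pow (h4.sub_const (X p ω)).enorm
    have a : liminf (fun n => ‖X (dyadic n (dyadicFloor n p)) ω - X p ω‖ₑ ^ 6) atTop = 0 := a
    rw [h3.liminf_eq] at a
    rw [← sub_eq_zero, ← enorm_eq_zero]
    exact eq_zero_of_pow_eq_zero a

end Kolmogorov

end WienerFlow

namespace WienerFlow

/-! ### The flow on path space -/

open scoped ENNReal

theorem lintegral_enorm_pow_gaussianReal_zero_one_lt_top (n : ℕ) :
    ∫⁻ x, ‖x‖ₑ ^ n ∂(gaussianReal 0 1) < ∞ := by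
  have h1 : MemLp id (n : ℝ≥0∞) (gaussianReal 0 1) := by
    exact_mod_cast memLp_id_gaussianReal (μ := 0) (v := 1) (n : NNReal)
  have h2 := h1.integrable_norm_pow'
  refine lt_of_le_of_lt (le_of_eq (lintegral_congr fun x => ?_)) h2.hasFiniteIntegral
  rw [enorm_pow, enorm_norm, id]

namespace IsAbstractWienerSpace

variable {H E : Type*} [NormedAddCommGroup H] [InnerProductSpace ℝ H] [CompleteSpace H]
  [NormedAddCommGroup E] [NormedSpace ℝ E] [MeasurableSpace E] [BorelSpace E]
  {ι : H →L[ℝ] E} {W : Measure E}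

theorem lintegral_enorm_pow_of_ae_eq (hW : IsAbstractWienerSpace ι W) {X : E → ℝ} {g : H}
    (hX : X =ᵐ[W] hW.paleyWiener g) (n : ℕ) :
    ∫⁻ ω, ‖X ω‖ₑ ^ n ∂W = ENNReal.ofReal ‖g‖ ^ n * ∫⁻ x, ‖x‖ₑ ^ n ∂(gaussianReal 0 1) := by
  have hm := (hW.memLp_of_ae_eq hX).aestronglyMeasurable.aemeasurable
  have h1 : W.map X = (gaussianReal 0 1).map (‖g‖ * ·) := by
    rw [hW.map_of_ae_eq hX, gaussianReal_map_const_mul, mul_zero, mul_one]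
    congr 1
  have h2 : ∫⁻ ω, ‖X ω‖ₑ ^ n ∂W = ∫⁻ x, ‖x‖ₑ ^ n ∂(W.map X) :=
    (lintegral_map' (f := fun x : ℝ => ‖x‖ₑ ^ n)
      (continuous_enorm.measurable.pow_const n).aemeasurable hm).symm
  rw [h2, h1, lintegral_map (by fun_prop) (by fun_prop), ← lintegral_const_mul _ (by fun_prop)]
  refine lintegral_congr fun x => ?_
  rw [enorm_mul, mul_pow, Real.enorm_of_nonneg (norm_nonneg g)]

theorem sub_ae_eq (hW : IsAbstractWienerSpace ι W) {X Y : E → ℝ} {g h : H}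
    (hX : X =ᵐ[W] hW.paleyWiener g) (hY : Y =ᵐ[W] hW.paleyWiener h) :
    (fun ω => X ω - Y ω) =ᵐ[W] hW.paleyWiener (g - h) := by
  rw [map_sub]
  filter_upwards [hX, hY, Lp.coeFn_sub (hW.paleyWiener g) (hW.paleyWiener h)] with ω h1 h2 h3
  rw [h1, h2, h3, Pi.sub_apply]

end IsAbstractWienerSpace

open EnergySpace

/-- `Sᵘω(t)` is the Paley–Wiener integral of `flowKernel u t`. -/
theorem apply_ae_eq_paleyWiener_flowKernel {W : Measure PathSpace}
    {hW : IsAbstractWienerSpace toPath W} {S : ℝ → PathSpace → PathSpace}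
    (hS : ∀ u, hW.IsTransform (flow u) (S u)) (u t : ℝ) :
    (fun ω => S u ω t) =ᵐ[W] hW.paleyWiener (flowKernel u t) := by
  have h1 := (hS u).dual_comp_ae_eq (PathSpace.eval t)
  rwa [dualVec_eval] at h1

theorem isOrnsteinUhlenbeck_of_ae_eq {W : Measure PathSpace}
    (hW : IsAbstractWienerSpace toPath W) {X : ℝ → PathSpace → ℝ} {u : ℝ}
    (hX : ∀ t, X t =ᵐ[W] hW.paleyWiener (flowKernel u t))
    (hc : ∀ ω, Continuous fun t => X t ω) : IsOrnsteinUhlenbeck X W where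
  isGaussianProcess := hW.isGaussianProcess_of_ae_eq hX
  centered t := hW.integral_of_ae_eq (hX t)
  covariance s t := by rw [hW.integral_mul_of_ae_eq (hX s) (hX t), inner_flowKernel_self]
  continuous_paths := .of_forall hc

/-- The Gram matrix of the vectors `flowKernel u t` depends on differences of the parameters
only. -/
theorem inner_flowKernel_add (a p q : ℝ × ℝ) :
    ⟪flowKernel (p + a).1 (p + a).2, flowKernel (q + a).1 (q + a).2⟫_ℝ =
      ⟪flowKernel p.1 p.2, flowKernel q.1 q.2⟫_ℝ := by
  rw [← Complex.ofReal_inj, inner_flowKernel, inner_flowKernel]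
  simp only [Prod.fst_add, Prod.snd_add, Complex.ofReal_add, add_sub_add_right_eq_sub]

/-- Sixth Gaussian moments scale as `‖flowKernel p - flowKernel q‖ ^ 6`, hence as the third power of
the distance of the parameters. -/
theorem exists_continuous_modification_flow {W : Measure PathSpace}
    (hW : IsAbstractWienerSpace toPath W) {X : ℝ × ℝ → PathSpace → ℝ}
    (hX : ∀ p, X p =ᵐ[W] hW.paleyWiener (flowKernel p.1 p.2)) :
    ∃ Y : ℝ × ℝ → PathSpace → ℝ, (∀ p, Measurable (Y p)) ∧ (∀ p, Y p =ᵐ[W] X p) ∧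
      ∀ ω, Continuous fun p => Y p ω := by
  refine exists_continuous_modification
    (C := ENNReal.ofReal (2 * Real.pi + 1) ^ 3 * ∫⁻ x, ‖x‖ₑ ^ 6 ∂(gaussianReal 0 1))
    (fun p => (hW.memLp_of_ae_eq (hX p)).aestronglyMeasurable.aemeasurable)
    (ENNReal.mul_lt_top (by finiteness)
      (lintegral_enorm_pow_gaussianReal_zero_one_lt_top 6)).ne fun p q => ?_
  rw [hW.lintegral_enorm_pow_of_ae_eq (hW.sub_ae_eq (hX p) (hX q)), mul_right_comm, ← mul_pow,
    ← ENNReal.ofReal_mul (by positivity), pow_mul _ 2 3, ← ENNReal.ofReal_pow (norm_nonneg _)]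
  gcongr
  exact norm_flowKernel_sub_sq_le p q

end WienerFlow

theorem mainTheorem4 (W : Measure PathSpace)
    (hW : IsAbstractWienerSpace EnergySpace.toPath W) :
    (∃ S : ℝ → PathSpace → PathSpace, ∀ u, hW.IsTransform (EnergySpace.flow u) (S u)) ∧
    ∀ S : ℝ → PathSpace → PathSpace, (∀ u, hW.IsTransform (EnergySpace.flow u) (S u)) →
      -- a centred Gaussian family in `L²(W)`
      IsGaussianProcess (fun (p : ℝ × ℝ) (ω : PathSpace) => S p.1 ω p.2) W ∧
      (∀ u t : ℝ, MemLp (fun ω => S u ω t) 2 W ∧ ∫ ω, S u ω t ∂W = 0) ∧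
      -- the covariance
      (∀ u v s t : ℝ, ((∫ ω, S u ω s * S v ω t ∂W : ℝ) : ℂ) =
        2 / Real.pi * ∫ l : ℝ, Complex.exp (Complex.I *
          ((t - s) * l + 2 * (u - v) * (Real.arctan (2 * l) : ℝ))) / (1 + 4 * (l : ℂ) ^ 2)) ∧
      -- stationarity
      (∀ (a : ℝ × ℝ) (I : Finset (ℝ × ℝ)),
        IdentDistrib (fun (ω : PathSpace) (p : I) => S (p.1 + a).1 ω (p.1 + a).2)
          (fun (ω : PathSpace) (p : I) => S p.1.1 ω p.1.2) W W) ∧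
      -- the bound on the covariance
      (∃ C : ℝ, ∀ u v s t : ℝ, |1 - ∫ ω, S u ω s * S v ω t ∂W| ≤
        C * (|u - v| + |t - s| * (1 + Real.log (1 + 1 / (t - s) ^ 2)))) ∧
      -- for each fixed `u`, an Ornstein–Uhlenbeck process
      (∀ u : ℝ, IsOrnsteinUhlenbeck (fun (t : ℝ) (ω : PathSpace) => S u ω t) W) ∧
      -- a jointly continuous modification, with the same restrictions
      ∃ Y : ℝ × ℝ → PathSpace → ℝ, (∀ p, Measurable (Y p)) ∧
        (∀ p : ℝ × ℝ, ∀ᵐ ω ∂W, Y p ω = S p.1 ω p.2) ∧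
        (∀ ω, Continuous fun p => Y p ω) ∧
        ∀ u : ℝ, IsOrnsteinUhlenbeck (fun (t : ℝ) (ω : PathSpace) => Y (u, t) ω) W := by
  refine ⟨?_, fun S hS => ?_⟩
  · choose S hS using fun u => hW.exists_isTransform (EnergySpace.flow u)
      (fun q : ℚ => PathSpace.eval q) fun ω hω => PathSpace.eq_zero_of_eval_rat hω
    exact ⟨S, hS⟩
  have hae := apply_ae_eq_paleyWiener_flowKernel hS
  have hcov (u v s t : ℝ) := hW.integral_mul_of_ae_eq (hae u s) (hae v t)
  refine ⟨hW.isGaussianProcess_of_ae_eq (g := fun p => EnergySpace.flowKernel p.1 p.2)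
      fun p => hae p.1 p.2,
    fun u t => ⟨hW.memLp_of_ae_eq (hae u t), hW.integral_of_ae_eq (hae u t)⟩,
    fun u v s t => ?_, fun a I => ?_, ⟨Real.pi, fun u v s t => ?_⟩,
    fun u => isOrnsteinUhlenbeck_of_ae_eq hW (hae u) fun ω => (S u ω).continuous, ?_⟩
  · rw [hcov, EnergySpace.inner_flowKernel]
  · exact hW.identDistrib_of_inner_eq
      (X := fun (p : I) ω => S (p.1 + a).1 ω (p.1 + a).2) (X' := fun (p : I) ω => S p.1.1 ω p.1.2)
      (fun p => hae _ _) (fun p => hae _ _) fun p q => inner_flowKernel_add a p.1 q.1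
  · rw [hcov]
    refine (EnergySpace.abs_one_sub_inner_flowKernel_le u v s t).trans ?_
    have h1 : 0 ≤ Real.log (1 + 1 / (t - s) ^ 2) :=
      Real.log_nonneg (le_add_of_nonneg_right (by positivity))
    -- the logarithmic factor is at least one, so it can be inserted for free
    nlinarith [mul_nonneg (abs_nonneg (t - s)) h1, abs_nonneg (t - s), Real.pi_gt_three,
      mul_nonneg Real.pi_pos.le (mul_nonneg (abs_nonneg (t - s)) h1)]
  · obtain ⟨Y, hYm, hYae, hYc⟩ := exists_continuous_modification_flow hW
      (X := fun p ω => S p.1 ω p.2) fun p => hae p.1 p.2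
    exact ⟨Y, hYm, hYae, hYc, fun u => isOrnsteinUhlenbeck_of_ae_eq hW
      (fun t => (hYae (u, t)).trans (hae u t))
      fun ω => (hYc ω).comp (Continuous.prodMk_right u)⟩
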